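/- Let $(M,g)$ be a smooth finite-dimensional pseudo-Riemannian manifold with Levi-Civita connection $\nabla$, curvature tensor $R(X,Y)=\nabla_{[X,Y]}-[\nabla_X,\nabla_Y]$, Ricci curvature $\mathrm{ric}(u,v)=\mathrm{tr}(a\mapsto R(u,a)v)$ and Ricci operator $\mathrm{Ric}$ given by $g(\mathrm{Ric}\,u,v)=\mathrm{ric}(u,v)$. Suppose that $(M,g)$ is semi-symmetric, i.e. $[R(X,Y),R(Z,T)]=R(R(X,Y)Z,T)+R(Z,R(X,Y)T)$ for all vector fields $X,Y,Z,T$. Let $U\subset M$ be an open set (for instance $U=M$) and let $P_1,\dots,P_r$ be real polynomials whose coefficients depend smoothly on the point $m\in U$ (for instance constant ones) such that for every $m\in U$ the polynomials $P_{1}(m),\dots,P_{r}(m)$ are, without repetition, the monic irreducible factors different from the polynomial $X$ of the minimal polynomial of $\mathrm{Ric}_m$. Put $$V_0(m)=\ker(\mathrm{Ric}_m^2),\qquad V_i(m)=\ker\big(P_{i}(m)(\mathrm{Ric}_m)\big)\quad(1\le i\le r).$$ For families $D,D',D''$ of subspaces of the tangent spaces, write $\nabla_{D}D'\subset D''$ if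 for every open $W\subset U$ and all smooth vector fields $X,Y$ on $W$ with values in $D$ and $D'$ respectively, $\nabla_XY$ has values in $D''$. Then for all $i,j\in\{1,\dots,r\}$ with $i\ne j$, $$\nabla_{V_j}V_i\subset V_i,$$ and for all $i\in\{1,\dots,r\}$, $$\nabla_{V_i}V_i\subset V_0+V_i,\qquad \nabla_{V_0}V_i\subset V_i,\qquad \nabla_{V_0}V_0\subset V_0,\qquad \nabla_{V_i}V_0\subset V_0+V_i$$ (the inclusion $\nabla_{V_0}V_0\subset V_0$ also holds when $r=0$). Moreover $V_0$ and each $V_0+V_i$ are involutive: on every open $W\subset U$, the Lie bracket of two smooth vector fields with values in the family again has values in it. -/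

import Mathlib

open scoped Manifold ContDiff Bundle Topology

set_option linter.unusedSectionVars false

noncomputable section

namespace PseudoRiem

variable {E : Type*} [NormedAddCommGroup E] [NormedSpace ℝ E] [FiniteDimensional ℝ E]
  {M : Type*} [TopologicalSpace M] [ChartedSpace E M] [IsManifold 𝓘(ℝ, E) ∞ M]

instance (x : M) : FiniteDimensional ℝ (TangentSpace 𝓘(ℝ, E) x) :=
  inferInstanceAs (FiniteDimensional ℝ E)

instance (x : M) : T2Space (TangentSpace 𝓘(ℝ, E) x) := inferInstanceAs (T2Space E)

variable (E M) in
/-- A smooth pseudo-Riemannian metric on `M`: a smooth field of symmetric nondegenerate bilinear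
forms on the tangent spaces. -/
structure Metric where
  /-- the bilinear form on each tangent space -/
  val (x : M) : TangentSpace 𝓘(ℝ, E) x →L[ℝ] TangentSpace 𝓘(ℝ, E) x →L[ℝ] ℝ
  symm (x : M) (v w : TangentSpace 𝓘(ℝ, E) x) : val x v w = val x w v
  nondegenerate (x : M) (v : TangentSpace 𝓘(ℝ, E) x) (hv : ∀ w, val x v w = 0) : v = 0
  contMDiff : ContMDiff 𝓘(ℝ, E) (𝓘(ℝ, E).prod 𝓘(ℝ, E →L[ℝ] E →L[ℝ] ℝ)) ∞
    (fun x ↦ Bundle.TotalSpace.mk' (E →L[ℝ] E →L[ℝ] ℝ)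
      (E := fun x : M ↦ TangentSpace 𝓘(ℝ, E) x →L[ℝ] TangentSpace 𝓘(ℝ, E) x →L[ℝ] ℝ) x (val x))

namespace Metric

variable (g : Metric E M)

/-- The musical isomorphism `v ↦ g(v, ·)`. -/
def flat (x : M) : TangentSpace 𝓘(ℝ, E) x ≃ₗ[ℝ] Module.Dual ℝ (TangentSpace 𝓘(ℝ, E) x) :=
  LinearMap.linearEquivOfInjective
    ((ContinuousLinearMap.coeLM ℝ).comp (g.val x : TangentSpace 𝓘(ℝ, E) x →ₗ[ℝ] _))
    (by
      rw [← LinearMap.ker_eq_bot, LinearMap.ker_eq_bot']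
      intro v hv
      exact g.nondegenerate x v fun w ↦ congrArg (fun f : Module.Dual ℝ _ ↦ f w) hv)
    (Subspace.dual_finrank_eq).symm

@[simp] lemma flat_apply (x : M) (v w : TangentSpace 𝓘(ℝ, E) x) : g.flat x v w = g.val x v w :=
  rfl

lemma val_flat_symm (x : M) (f : Module.Dual ℝ (TangentSpace 𝓘(ℝ, E) x))
    (w : TangentSpace 𝓘(ℝ, E) x) : g.val x ((g.flat x).symm f) w = f w := by
  rw [← flat_apply, LinearEquiv.apply_symm_apply]

lemma mdifferentiableAt_val {X Y : Π x : M, TangentSpace 𝓘(ℝ, E) x} {x : M}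
    (hX : MDiffAt (T% X) x) (hY : MDiffAt (T% Y) x) :
    MDiffAt (fun y ↦ g.val y (X y) (Y y)) x := by
  have : MDifferentiableAt 𝓘(ℝ, E) (𝓘(ℝ, E).prod 𝓘(ℝ))
      (fun m ↦ Bundle.TotalSpace.mk' ℝ (E := Bundle.Trivial M ℝ) m (g.val m (X m) (Y m))) x := by
    apply MDifferentiableAt.clm_bundle_apply₂ (F₁ := E) (F₂ := E)
    · exact (g.contMDiff x).mdifferentiableAt (by simp)
    · exact hX
    · exact hY
  simp only [mdifferentiableAt_totalSpace] at this
  exact this.2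

/-- The differential at `x` of the function `g(X, Y)`. -/
def dVal (X Y : Π x : M, TangentSpace 𝓘(ℝ, E) x) (x : M) : TangentSpace 𝓘(ℝ, E) x →L[ℝ] ℝ :=
  mvfderiv 𝓘(ℝ, E) (fun y ↦ g.val y (X y) (Y y)) x

lemma dVal_comm (X Y : Π x : M, TangentSpace 𝓘(ℝ, E) x) (x : M) :
    g.dVal X Y x = g.dVal Y X x := by
  simp only [dVal, fun y ↦ g.symm y (X y) (Y y)]

lemma dVal_smul_left {X Y : Π x : M, TangentSpace 𝓘(ℝ, E) x} {f : M → ℝ} {x : M}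
    (hf : MDiffAt f x) (hX : MDiffAt (T% X) x) (hY : MDiffAt (T% Y) x) :
    g.dVal (f • X) Y x
      = f x • g.dVal X Y x + (g.val x (X x) (Y x)) • mvfderiv 𝓘(ℝ, E) f x := by
  simpa [dVal] using mvfderiv_fun_mul hf (g.mdifferentiableAt_val hX hY)

lemma dVal_add_left {X X' Y : Π x : M, TangentSpace 𝓘(ℝ, E) x} {x : M}
    (hX : MDiffAt (T% X) x) (hX' : MDiffAt (T% X') x) (hY : MDiffAt (T% Y) x) :
    g.dVal (X + X') Y x = g.dVal X Y x + g.dVal X' Y x := by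
  simpa [dVal] using mvfderiv_fun_add (g.mdifferentiableAt_val hX hY) (g.mdifferentiableAt_val hX' hY)

lemma dVal_smul_right {X Y : Π x : M, TangentSpace 𝓘(ℝ, E) x} {f : M → ℝ} {x : M}
    (hf : MDiffAt f x) (hX : MDiffAt (T% X) x) (hY : MDiffAt (T% Y) x) :
    g.dVal Y (f • X) x
      = f x • g.dVal Y X x + (g.val x (Y x) (X x)) • mvfderiv 𝓘(ℝ, E) f x := by
  rw [g.dVal_comm, g.dVal_smul_left hf hX hY, g.dVal_comm, g.symm]

lemma dVal_add_right {X X' Y : Π x : M, TangentSpace 𝓘(ℝ, E) x} {x : M}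
    (hX : MDiffAt (T% X) x) (hX' : MDiffAt (T% X') x) (hY : MDiffAt (T% Y) x) :
    g.dVal Y (X + X') x = g.dVal Y X x + g.dVal Y X' x := by
  rw [g.dVal_comm, g.dVal_add_left hX hX' hY, g.dVal_comm, g.dVal_comm X']

/-- The right-hand side of the Koszul formula, that is, the expression that
equals `2 g(∇_X Y, Z)`. -/
def koszul (X Y Z : Π x : M, TangentSpace 𝓘(ℝ, E) x) (x : M) : ℝ :=
  g.dVal Y Z x (X x) + g.dVal X Z x (Y x) - g.dVal X Y x (Z x)
    + g.val x (VectorField.mlieBracket 𝓘(ℝ, E) X Y x) (Z x)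
    - g.val x (VectorField.mlieBracket 𝓘(ℝ, E) X Z x) (Y x)
    - g.val x (VectorField.mlieBracket 𝓘(ℝ, E) Y Z x) (X x)

lemma koszul_tensorial_left {Y Z : Π x : M, TangentSpace 𝓘(ℝ, E) x} {x : M}
    (hY : MDiffAt (T% Y) x) (hZ : MDiffAt (T% Z) x) :
    TensorialAt 𝓘(ℝ, E) E (fun X ↦ g.koszul X Y Z x) x where
  smul {f X} hf hX := by
    simp [koszul, g.dVal_smul_left hf hX hZ, g.dVal_smul_left hf hX hY,
      VectorField.mlieBracket_smul_left hf hX]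
    ring
  add {X X'} hX hX' := by
    simp [koszul, g.dVal_add_left hX hX' hZ, g.dVal_add_left hX hX' hY,
      VectorField.mlieBracket_add_left hX hX']
    ring

lemma koszul_tensorial_right {X Y : Π x : M, TangentSpace 𝓘(ℝ, E) x} {x : M}
    (hX : MDiffAt (T% X) x) (hY : MDiffAt (T% Y) x) :
    TensorialAt 𝓘(ℝ, E) E (fun Z ↦ g.koszul X Y Z x) x where
  smul {f Z} hf hZ := by
    simp [koszul, g.dVal_smul_right hf hZ hX, g.dVal_smul_right hf hZ hY,
      VectorField.mlieBracket_smul_right hf hZ]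
    linear_combination mvfderiv 𝓘(ℝ, E) f x (X x) * g.symm x (Y x) (Z x)
      + mvfderiv 𝓘(ℝ, E) f x (Y x) * g.symm x (X x) (Z x)
  add {Z Z'} hZ hZ' := by
    simp [koszul, g.dVal_add_right hZ hZ' hX, g.dVal_add_right hZ hZ' hY,
      VectorField.mlieBracket_add_right hZ hZ']
    ring

lemma koszul_smul_mid {X Y Z : Π x : M, TangentSpace 𝓘(ℝ, E) x} {f : M → ℝ} {x : M}
    (hf : MDiffAt f x) (hX : MDiffAt (T% X) x) (hY : MDiffAt (T% Y) x) (hZ : MDiffAt (T% Z) x) :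
    g.koszul X (f • Y) Z x = f x * g.koszul X Y Z x
      + 2 * (mvfderiv 𝓘(ℝ, E) f x (X x) * g.val x (Y x) (Z x)) := by
  simp [koszul, g.dVal_smul_left hf hY hZ, g.dVal_smul_right hf hY hX,
    VectorField.mlieBracket_smul_left hf hY, VectorField.mlieBracket_smul_right hf hY]
  linear_combination mvfderiv 𝓘(ℝ, E) f x (Z x) * g.symm x (Y x) (X x)

lemma koszul_add_mid {X Y Y' Z : Π x : M, TangentSpace 𝓘(ℝ, E) x} {x : M}
    (hX : MDiffAt (T% X) x) (hY : MDiffAt (T% Y) x) (hY' : MDiffAt (T% Y') x)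
    (hZ : MDiffAt (T% Z) x) :
    g.koszul X (Y + Y') Z x = g.koszul X Y Z x + g.koszul X Y' Z x := by
  simp [koszul, g.dVal_add_left hY hY' hZ, g.dVal_add_right hY hY' hX,
    VectorField.mlieBracket_add_left hY hY', VectorField.mlieBracket_add_right hY hY']
  ring

open Classical in
/-- The bilinear form `(u, w) ↦ 2 g(∇_u Y, w)` on the tangent space at `x`, for a vector field `Y`
that is differentiable at `x` (and `0` by convention for other vector fields). -/
def koszulForm (Y : Π x : M, TangentSpace 𝓘(ℝ, E) x) (x : M) :
    TangentSpace 𝓘(ℝ, E) x →L[ℝ] TangentSpace 𝓘(ℝ, E) x →L[ℝ] ℝ :=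
  if hY : MDiffAt (T% Y) x then
    TensorialAt.mkHom₂ (fun X Z ↦ g.koszul X Y Z x) x
      (fun _ hZ ↦ g.koszul_tensorial_left hY hZ) (fun _ hX ↦ g.koszul_tensorial_right hX hY)
  else 0

lemma koszulForm_apply {X Y Z : Π x : M, TangentSpace 𝓘(ℝ, E) x} {x : M}
    (hX : MDiffAt (T% X) x) (hY : MDiffAt (T% Y) x) (hZ : MDiffAt (T% Z) x) :
    g.koszulForm Y x (X x) (Z x) = g.koszul X Y Z x := by
  rw [koszulForm, dif_pos hY]
  exact TensorialAt.mkHom₂_apply _ _ hX hZ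

/-- The vector-valued one-form `u ↦ ∇_u Y`, determined by the Koszul formula. -/
def leviCivitaFun (Y : Π x : M, TangentSpace 𝓘(ℝ, E) x) (x : M) :
    TangentSpace 𝓘(ℝ, E) x →L[ℝ] TangentSpace 𝓘(ℝ, E) x :=
  LinearMap.toContinuousLinearMap ((g.flat x).symm.toLinearMap ∘ₗ
    ((2⁻¹ : ℝ) • ((ContinuousLinearMap.coeLM ℝ).comp
      (g.koszulForm Y x : TangentSpace 𝓘(ℝ, E) x →ₗ[ℝ] _))))

/-- The Koszul formula. -/
lemma two_mul_val_leviCivitaFun {X Y Z : Π x : M, TangentSpace 𝓘(ℝ, E) x} {x : M}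
    (hX : MDiffAt (T% X) x) (hY : MDiffAt (T% Y) x) (hZ : MDiffAt (T% Z) x) :
    2 * g.val x (g.leviCivitaFun Y x (X x)) (Z x) = g.koszul X Y Z x := by
  rw [← g.koszulForm_apply hX hY hZ]
  have : g.val x (g.leviCivitaFun Y x (X x)) (Z x) = 2⁻¹ * g.koszulForm Y x (X x) (Z x) :=
    g.val_flat_symm x _ _
  rw [this]
  ring

lemma ext_val {x : M} {A B : TangentSpace 𝓘(ℝ, E) x →L[ℝ] TangentSpace 𝓘(ℝ, E) x}
    (h : ∀ X Z : Π x : M, TangentSpace 𝓘(ℝ, E) x, MDiffAt (T% X) x → MDiffAt (T% Z) x →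
      2 * g.val x (A (X x)) (Z x) = 2 * g.val x (B (X x)) (Z x)) : A = B := by
  ext v
  rw [← sub_eq_zero]
  refine g.nondegenerate x _ fun w ↦ ?_
  have := h (FiberBundle.extend E v) (FiberBundle.extend E w)
    (FiberBundle.mdifferentiableAt_extend ..) (FiberBundle.mdifferentiableAt_extend ..)
  simp only [FiberBundle.extend_apply_self] at this
  simp only [map_sub, sub_apply]
  linarith

/-- The Levi-Civita connection of a pseudo-Riemannian metric. -/
def leviCivita : CovariantDerivative 𝓘(ℝ, E) E (TangentSpace 𝓘(ℝ, E) : M → Type _) where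
  toFun := g.leviCivitaFun
  isCovariantDerivativeOnUniv :=
    { add := by
        intro Y Y' x hY hY' _
        refine g.ext_val fun X Z hX hZ ↦ ?_
        rw [g.two_mul_val_leviCivitaFun hX (mdifferentiableAt_add_section hY hY') hZ,
          g.koszul_add_mid hX hY hY' hZ, ← g.two_mul_val_leviCivitaFun hX hY hZ,
          ← g.two_mul_val_leviCivitaFun hX hY' hZ]
        simp
        ring
      leibniz := by
        intro Y f x hY hf _
        refine g.ext_val fun X Z hX hZ ↦ ?_
        rw [g.two_mul_val_leviCivitaFun hX (hf.smul_section hY) hZ,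
          g.koszul_smul_mid hf hX hY hZ, ← g.two_mul_val_leviCivitaFun hX hY hZ]
        simp
        ring }

/-- The Levi-Civita connection is torsion-free. -/
theorem leviCivita_torsion {X Y : Π x : M, TangentSpace 𝓘(ℝ, E) x} {x : M}
    (hX : MDiffAt (T% X) x) (hY : MDiffAt (T% Y) x) :
    g.leviCivita Y x (X x) - g.leviCivita X x (Y x) = VectorField.mlieBracket 𝓘(ℝ, E) X Y x := by
  rw [← sub_eq_zero]
  refine g.nondegenerate x _ fun w ↦ ?_
  have hZ := FiberBundle.mdifferentiableAt_extend (I := 𝓘(ℝ, E)) (F := E) w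
  have h1 := g.two_mul_val_leviCivitaFun hX hY hZ
  have h2 := g.two_mul_val_leviCivitaFun hY hX hZ
  have h3 : VectorField.mlieBracket 𝓘(ℝ, E) Y X x = - VectorField.mlieBracket 𝓘(ℝ, E) X Y x :=
    VectorField.mlieBracket_swap_apply
  simp only [koszul, FiberBundle.extend_apply_self, h3, g.dVal_comm Y X, map_neg,
    neg_apply] at h1 h2
  simp only [map_sub, sub_apply, leviCivita]
  linarith

/-- The Levi-Civita connection is compatible with the metric. -/
theorem leviCivita_metric {X Y Z : Π x : M, TangentSpace 𝓘(ℝ, E) x} {x : M}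
    (hX : MDiffAt (T% X) x) (hY : MDiffAt (T% Y) x) (hZ : MDiffAt (T% Z) x) :
    mvfderiv 𝓘(ℝ, E) (fun y ↦ g.val y (Y y) (Z y)) x (X x)
      = g.val x (g.leviCivita Y x (X x)) (Z x) + g.val x (Y x) (g.leviCivita Z x (X x)) := by
  have h1 := g.two_mul_val_leviCivitaFun hX hY hZ
  have h2 := g.two_mul_val_leviCivitaFun hX hZ hY
  have h3 : VectorField.mlieBracket 𝓘(ℝ, E) Z Y x = - VectorField.mlieBracket 𝓘(ℝ, E) Y Z x :=
    VectorField.mlieBracket_swap_apply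
  simp only [koszul, h3, g.dVal_comm Z Y, map_neg, neg_apply] at h1 h2
  rw [g.symm x (Y x)]
  change g.dVal Y Z x (X x) = g.val x (g.leviCivitaFun Y x (X x)) (Z x)
    + g.val x (g.leviCivitaFun Z x (X x)) (Y x)
  linarith

/-- The curvature `R(X, Y)Z = ∇_[X,Y] Z - (∇_X ∇_Y Z - ∇_Y ∇_X Z)` of the Levi-Civita connection
on vector fields. -/
def curvature (X Y Z : Π x : M, TangentSpace 𝓘(ℝ, E) x) (x : M) : TangentSpace 𝓘(ℝ, E) x :=
  g.leviCivita Z x (VectorField.mlieBracket 𝓘(ℝ, E) X Y x)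
    - (g.leviCivita (fun y ↦ g.leviCivita Z y (Y y)) x (X x)
      - g.leviCivita (fun y ↦ g.leviCivita Z y (X y)) x (Y x))

/-- The `i`-th coordinate vector field of the preferred chart at `x`, which is smooth near `x`. -/
def coordField (x : M) (i : Fin (Module.finrank ℝ E)) : Π y : M, TangentSpace 𝓘(ℝ, E) y :=
  FiberBundle.extend E (x := x) (Module.finBasis ℝ (TangentSpace 𝓘(ℝ, E) x) i)

/-- The Riemann curvature tensor at `x`: the trilinear map whose components are the values at `x` of
`R(∂ᵢ, ∂ⱼ)∂ₖ` for the coordinate vector fields at `x`. -/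
def riemann (x : M) : TangentSpace 𝓘(ℝ, E) x →ₗ[ℝ] TangentSpace 𝓘(ℝ, E) x →ₗ[ℝ]
    TangentSpace 𝓘(ℝ, E) x →ₗ[ℝ] TangentSpace 𝓘(ℝ, E) x :=
  let b := Module.finBasis ℝ (TangentSpace 𝓘(ℝ, E) x)
  b.constr ℝ fun i ↦ b.constr ℝ fun j ↦ b.constr ℝ fun k ↦
    g.curvature (coordField x i) (coordField x j) (coordField x k) x

/-- The manifold is semi-symmetric, `R.R = 0`:
`[R(u,v), R(z,t)] = R(R(u,v)z, t) + R(z, R(u,v)t)`. -/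
def IsSemiSymmetric : Prop :=
  ∀ (x : M) (u v z t : TangentSpace 𝓘(ℝ, E) x),
    g.riemann x u v ∘ₗ g.riemann x z t - g.riemann x z t ∘ₗ g.riemann x u v
      = g.riemann x (g.riemann x u v z) t + g.riemann x z (g.riemann x u v t)

/-- The Ricci curvature `ric(u, v) = tr (a ↦ R(u, a)v)`. -/
def ricciForm (x : M) : TangentSpace 𝓘(ℝ, E) x →ₗ[ℝ] Module.Dual ℝ (TangentSpace 𝓘(ℝ, E) x) :=
  LinearMap.mk₂ ℝ (fun u v ↦ LinearMap.trace ℝ _ ((g.riemann x u).flip v))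
    (fun u u' v ↦ by rw [← map_add]; congr 1; ext a; simp)
    (fun c u v ↦ by rw [← map_smul]; congr 1; ext a; simp)
    (fun u v v' ↦ by rw [← map_add]; congr 1; ext a; simp)
    (fun c u v ↦ by rw [← map_smul]; congr 1; ext a; simp)

/-- The Ricci operator, `g(Ric u, v) = ric(u, v)`. -/
def ricci (x : M) : Module.End ℝ (TangentSpace 𝓘(ℝ, E) x) :=
  (g.flat x).symm.toLinearMap ∘ₗ g.ricciForm x

/-- On `U`, the polynomials `P 0 m, …, P (r - 1) m` depend smoothly on the point `m`, and are, without
repetition, the monic irreducible factors other than `X` of the minimal polynomial of the Ricci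
operator at `m`. -/
structure IsRicciFactorFamily (U : Set M) {r : ℕ} (P : Fin r → M → Polynomial ℝ) : Prop where
  smooth : ∀ i k, ContMDiffOn 𝓘(ℝ, E) 𝓘(ℝ) ∞ (fun m ↦ (P i m).coeff k) U
  injective : ∀ m ∈ U, Function.Injective fun i ↦ P i m
  factors : ∀ m ∈ U, ∀ Q : Polynomial ℝ, (∃ i, P i m = Q) ↔
    Q.Monic ∧ Irreducible Q ∧ Q ≠ Polynomial.X ∧ Q ∣ minpoly ℝ (g.ricci m)

/-- `V₀ = ker Ric²`. -/
def V₀ (x : M) : Submodule ℝ (TangentSpace 𝓘(ℝ, E) x) := LinearMap.ker (g.ricci x ^ 2)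

/-- `ker Q(Ric)`, for a polynomial `Q` that may depend on the point. -/
def kerRicci (Q : M → Polynomial ℝ) (x : M) : Submodule ℝ (TangentSpace 𝓘(ℝ, E) x) :=
  LinearMap.ker (Polynomial.aeval (g.ricci x) (Q x))

end Metric

/-- `X` is a smooth section over the set `W` of the family `D` of subspaces of the tangent
spaces. -/
def IsSectionOn (D : Π x : M, Submodule ℝ (TangentSpace 𝓘(ℝ, E) x))
    (X : Π x : M, TangentSpace 𝓘(ℝ, E) x) (W : Set M) : Prop :=
  ContMDiffOn 𝓘(ℝ, E) (𝓘(ℝ, E).prod 𝓘(ℝ, E)) ∞ (T% X) W ∧ ∀ x ∈ W, X x ∈ D x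

/-- `∇_{D₁} D₂ ⊂ D₃` on `U`: for all smooth local sections `X` of `D₁` and `Y` of `D₂`, the vector
field `∇_X Y` has values in `D₃`. -/
def Metric.CovDerivSubset (g : Metric E M) (U : Set M)
    (D₁ D₂ D₃ : Π x : M, Submodule ℝ (TangentSpace 𝓘(ℝ, E) x)) : Prop :=
  ∀ W ⊆ U, IsOpen W → ∀ X Y : Π x : M, TangentSpace 𝓘(ℝ, E) x,
    IsSectionOn D₁ X W → IsSectionOn D₂ Y W → ∀ x ∈ W, g.leviCivita Y x (X x) ∈ D₃ x

/-- `D` is involutive on `U`: the Lie bracket of two smooth local sections is a section. -/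
def IsInvolutiveOn (D : Π x : M, Submodule ℝ (TangentSpace 𝓘(ℝ, E) x)) (U : Set M) : Prop :=
  ∀ W ⊆ U, IsOpen W → ∀ X Y : Π x : M, TangentSpace 𝓘(ℝ, E) x,
    IsSectionOn D X W → IsSectionOn D Y W → ∀ x ∈ W, VectorField.mlieBracket 𝓘(ℝ, E) X Y x ∈ D x

end PseudoRiem

end

noncomputable section

namespace PseudoRiem

variable {E : Type*} [NormedAddCommGroup E] [NormedSpace ℝ E] [FiniteDimensional ℝ E]
  {M : Type*} [TopologicalSpace M] [ChartedSpace E M] [IsManifold 𝓘(ℝ, E) ∞ M]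

/-! Semi-symmetry says that each R(u,v) acts on R as a derivation that kills it. Applied to the
trace defining ric, this makes R(u,v) commute with Ric (`riemann_ricci`); the pair symmetry and the
first Bianchi identity then give R(Ric u,v)w = Ric R(u,v)w (`riemann_ricci_left`). So a polynomial
in Ric passes freely between the three slots of R and its value.

This has two algebraic consequences. If q(Ric) is nilpotent, then g(Ric q(Ric)u,v) is the trace of a
nilpotent operator, so Ric q(Ric) = 0 (`aeval_X_mul_eq_zero`); hence X² ∏ P_k annihilates Ric, and
each P_k occurs only once. And R vanishes as soon as two arguments lie in kernels of coprime
polynomials in Ric (`riemann_eq_zero`).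

The geometry is the second Bianchi identity. Let K_i be `complKer`, the kernel of X² ∏_{k≠i} P_k, a
complement of V_i. For sections X, W of K_i and Y, Z of V_i, the identity collapses to an equality
between -R(Y,Z)∇_X W, which lies in V_i, and R([Y,Z],X)W, which lies in K_i; so both vanish
(`riemann_nabla_eq_zero`). A vector killed by all curvature endomorphisms is in ker Ric, and Ric is
invertible on V_i, so ∇_X W has no component in V_i: K_i is totally geodesic (`nabla_mem_complKer`).
As K_i and V_i are orthogonal, metric compatibility makes V_i parallel along K_i
(`nabla_mem_kerRicci`).

Finally V_0 is the intersection of all K_j, and V_0 + V_i that of the K_j with j ≠ i (`mem_V₀`,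
`mem_V₀_sup`); every inclusion follows, and involutivity comes from vanishing torsion. -/

/-- Smoothness at a point of a vector field. -/
def SmoothAt (X : Π x : M, TangentSpace 𝓘(ℝ, E) x) (x : M) : Prop := CMDiffAt ∞ (T% X) x

/-! ### Closure properties of pointwise smoothness of vector fields. -/

namespace SmoothAt

variable {X Y Z : Π x : M, TangentSpace 𝓘(ℝ, E) x} {x : M} {f : M → ℝ}

lemma mdifferentiableAt (hX : SmoothAt X x) : MDiffAt (T% X) x :=
  ContMDiffAt.mdifferentiableAt hX (by simp)

lemma eventually_mdifferentiableAt (hX : SmoothAt X x) : ∀ᶠ y in 𝓝 x, MDiffAt (T% X) y := by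
  have h : CMDiffAt 1 (T% X) x := ContMDiffAt.of_le hX (by simp)
  exact ((contMDiffAt_iff_contMDiffAt_nhds (by simp)).1 h).mono
    fun y hy ↦ hy.mdifferentiableAt (by simp)

lemma add (hX : SmoothAt X x) (hY : SmoothAt Y x) : SmoothAt (X + Y) x :=
  ContMDiffAt.add_section hX hY

lemma sub (hX : SmoothAt X x) (hY : SmoothAt Y x) : SmoothAt (X - Y) x :=
  ContMDiffAt.sub_section hX hY

lemma smul (hf : CMDiffAt ∞ f x) (hX : SmoothAt X x) : SmoothAt (f • X) x :=
  ContMDiffAt.smul_section hf hX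

lemma sum {ι : Type*} {s : Finset ι} {X : ι → Π x : M, TangentSpace 𝓘(ℝ, E) x}
    (h : ∀ i ∈ s, SmoothAt (X i) x) : SmoothAt (fun y ↦ ∑ i ∈ s, X i y) x :=
  ContMDiffAt.sum_section h

lemma extend (v : TangentSpace 𝓘(ℝ, E) x) : SmoothAt (FiberBundle.extend E v) x :=
  FiberBundle.contMDiffAt_extend 𝓘(ℝ, E) E v

lemma eventually_extend (v : TangentSpace 𝓘(ℝ, E) x) :
    ∀ᶠ y in 𝓝 x, SmoothAt (FiberBundle.extend E v) y := by
  obtain ⟨s, hs, h⟩ := FiberBundle.exists_contMDiffOn_extend (k := ∞) 𝓘(ℝ, E) E v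
  filter_upwards [eventually_mem_nhds_iff.2 hs] with y hy
  exact h.contMDiffAt hy

lemma congr (hX : SmoothAt X x) (h : ∀ᶠ y in 𝓝 x, X y = Y y) : SmoothAt Y x := by
  refine ContMDiffAt.congr_of_eventuallyEq hX ?_
  filter_upwards [h] with y hy
  simp [hy]

lemma zero : SmoothAt (0 : Π x : M, TangentSpace 𝓘(ℝ, E) x) x :=
  Bundle.contMDiff_zeroSection ℝ (TangentSpace 𝓘(ℝ, E) : M → Type _) x

lemma mlieBracket (hX : SmoothAt X x) (hY : SmoothAt Y x) :
    SmoothAt (VectorField.mlieBracket 𝓘(ℝ, E) X Y) x := by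
  -- Here ∞ + 1 is again ∞, so the bracket loses no regularity.
  have : IsManifold 𝓘(ℝ, E) ((((⊤ : ℕ∞) : WithTop ℕ∞)) + 1) M :=
    inferInstanceAs (IsManifold 𝓘(ℝ, E) ∞ M)
  have : IsManifold 𝓘(ℝ, E) (minSmoothness ℝ 2) M := by
    rw [minSmoothness_of_isRCLikeNormedField]
    exact IsManifold.of_le (n := ∞) ENat.LEInfty.out
  exact ContMDiffAt.mlieBracket_vectorField (m := ⊤) (n := ⊤) hX hY (by simp)

end SmoothAt

/-! ### Local frames and their coefficients. -/

variable (E) in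
/-- The local frame of the tangent bundle given by the preferred trivialization at `x`. -/
def frame (x : M) (i : Fin (Module.finrank ℝ E)) : Π y : M, TangentSpace 𝓘(ℝ, E) y :=
  (trivializationAt E (TangentSpace 𝓘(ℝ, E) : M → Type _) x).localFrame (Module.finBasis ℝ E) i

variable (E) in
/-- The coefficients in the local frame `frame E x`. -/
def frameCoeff (x : M) (i : Fin (Module.finrank ℝ E)) (y : M) : TangentSpace 𝓘(ℝ, E) y →ₗ[ℝ] ℝ :=
  (trivializationAt E (TangentSpace 𝓘(ℝ, E) : M → Type _) x).localFrameCoeff 𝓘(ℝ, E) (Module.finBasis ℝ E) i y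

lemma eventually_mem_baseSet (x : M) :
    ∀ᶠ y in 𝓝 x, y ∈ (trivializationAt E (TangentSpace 𝓘(ℝ, E) : M → Type _) x).baseSet :=
  (trivializationAt E (TangentSpace 𝓘(ℝ, E) : M → Type _) x).open_baseSet.mem_nhds
    (FiberBundle.mem_baseSet_trivializationAt' x)

lemma eventually_smoothAt_frame (x : M) (i) : ∀ᶠ y in 𝓝 x, SmoothAt (frame E x i) y := by
  filter_upwards [eventually_mem_baseSet (E := E) x] with y hy
  exact contMDiffAt_localFrame_of_mem ∞ _ _ i hy

lemma smoothAt_frame (x : M) (i) : SmoothAt (frame E x i) x :=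
  (eventually_smoothAt_frame x i).self_of_nhds

lemma eventually_eq_sum_frame (x : M) : ∀ᶠ y in 𝓝 x, ∀ v : TangentSpace 𝓘(ℝ, E) y,
    v = ∑ i, frameCoeff E x i y v • frame E x i y := by
  filter_upwards [eventually_mem_baseSet (E := E) x] with y hy v
  have := Bundle.Trivialization.eq_sum_localFrameCoeff_smul (I := 𝓘(ℝ, E))
    (b := Module.finBasis ℝ E) (s := FiberBundle.extend E v) hy
  simpa [frame, frameCoeff] using this

lemma frameCoeff_smooth {X : Π x : M, TangentSpace 𝓘(ℝ, E) x} {x : M} (hX : SmoothAt X x) (i) :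
    CMDiffAt ∞ (fun y ↦ frameCoeff E x i y (X y)) x :=
  contMDiffAt_localFrameCoeff (Module.finBasis ℝ E) (FiberBundle.mem_baseSet_trivializationAt' x)
    hX i

/-- Turns the pointwise trace defining ric into a finite sum whose terms can be checked for
smoothness. -/
lemma eventually_trace_eq (x : M) : ∀ᶠ y in 𝓝 x, ∀ A : Module.End ℝ (TangentSpace 𝓘(ℝ, E) y),
    LinearMap.trace ℝ _ A = ∑ i, frameCoeff E x i y (A (frame E x i y)) := by
  filter_upwards [eventually_mem_baseSet (E := E) x] with y hy A
  rw [LinearMap.trace_eq_matrix_trace ℝ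
    (Bundle.Trivialization.basisAt _ (Module.finBasis ℝ E) hy) A]
  refine Finset.sum_congr rfl fun i _ ↦ ?_
  have := Bundle.Trivialization.localFrameCoeff_apply_of_mem_baseSet (I := 𝓘(ℝ, E))
    _ (Module.finBasis ℝ E) hy (FiberBundle.extend E (A (frame E x i y))) i
  rw [FiberBundle.extend_apply_self] at this
  rw [frameCoeff, this, Matrix.diag_apply, LinearMap.toMatrix_apply, frame,
    Bundle.Trivialization.localFrame_apply_of_mem_baseSet _ _ hy]

lemma frame_ne_zero (x : M) (i) : frame E x i x ≠ 0 := by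
  have hx := FiberBundle.mem_baseSet_trivializationAt' (F := E) (E := (TangentSpace 𝓘(ℝ, E) : M → Type _)) x
  rw [frame, Bundle.Trivialization.localFrame_apply_of_mem_baseSet _ _ hx]
  exact Module.Basis.ne_zero _ i

lemma frameCoeff_frame (x : M) (i) : ∀ᶠ y in 𝓝 x, frameCoeff E x i y (frame E x i y) = 1 := by
  filter_upwards [eventually_mem_baseSet (E := E) x] with y hy
  have := Bundle.Trivialization.localFrameCoeff_apply_of_mem_baseSet (I := 𝓘(ℝ, E))
    _ (Module.finBasis ℝ E) hy (frame E x i) i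
  rw [frameCoeff, this, frame, Bundle.Trivialization.localFrame_apply_of_mem_baseSet _ _ hy]
  simp

/-! ### Derivatives of functions along vector fields. -/

lemma eventually_mdifferentiableAt_of_smooth {f : M → ℝ} {x : M} (hf : CMDiffAt ∞ f x) :
    ∀ᶠ y in 𝓝 x, MDiffAt f y := by
  have h : CMDiffAt 1 f x := ContMDiffAt.of_le hf (by simp)
  exact ((contMDiffAt_iff_contMDiffAt_nhds (by simp)).1 h).mono
    fun y hy ↦ hy.mdifferentiableAt (by simp)

/-- The derivative of a smooth function along a smooth vector field is smooth. -/
lemma SmoothAt.mvfderiv_apply {X : Π x : M, TangentSpace 𝓘(ℝ, E) x} {x : M} {f : M → ℝ}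
    (hf : CMDiffAt ∞ f x) (hX : SmoothAt X x) :
    CMDiffAt ∞ (fun y ↦ mvfderiv 𝓘(ℝ, E) f y (X y)) x := by
  rcases isEmpty_or_nonempty (Fin (Module.finrank ℝ E)) with h | ⟨⟨i⟩⟩
  · have : ∀ᶠ y in 𝓝 x, mvfderiv 𝓘(ℝ, E) f y (X y) = 0 := by
      filter_upwards [eventually_eq_sum_frame (E := E) x] with y hy
      rw [hy (X y)]
      simp
    exact contMDiffAt_const.congr_of_eventuallyEq this
  have hZ := smoothAt_frame (E := E) x i
  -- This field is X(f) Z for the frame field Z, so X(f) is its Z-coefficient; smoothness of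
  -- brackets does the work. In dimension 0 there is no Z, whence the case split.
  have h1 : SmoothAt (VectorField.mlieBracket 𝓘(ℝ, E) X (f • frame E x i)
      - f • VectorField.mlieBracket 𝓘(ℝ, E) X (frame E x i)) x :=
    (hX.mlieBracket (.smul hf hZ)).sub (.smul hf (hX.mlieBracket hZ))
  refine (frameCoeff_smooth h1 i).congr_of_eventuallyEq ?_
  filter_upwards [eventually_mdifferentiableAt_of_smooth hf, hZ.eventually_mdifferentiableAt,
    frameCoeff_frame x i] with y hfy hZy hy
  simp [VectorField.mlieBracket_smul_right hfy hZy, hy]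

/-- The Lie bracket is the commutator of derivations. -/
lemma mvfderiv_mlieBracket {X Y : Π x : M, TangentSpace 𝓘(ℝ, E) x} {x : M} {f : M → ℝ}
    (hf : CMDiffAt ∞ f x) (hX : SmoothAt X x) (hY : SmoothAt Y x) :
    mvfderiv 𝓘(ℝ, E) f x (VectorField.mlieBracket 𝓘(ℝ, E) X Y x)
      = mvfderiv 𝓘(ℝ, E) (fun y ↦ mvfderiv 𝓘(ℝ, E) f y (Y y)) x (X x)
        - mvfderiv 𝓘(ℝ, E) (fun y ↦ mvfderiv 𝓘(ℝ, E) f y (X y)) x (Y x) := by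
  rcases isEmpty_or_nonempty (Fin (Module.finrank ℝ E)) with h | ⟨⟨i⟩⟩
  · have : ∀ v : TangentSpace 𝓘(ℝ, E) x, v = 0 := by
      intro v
      rw [(eventually_eq_sum_frame (E := E) x).self_of_nhds v]
      simp
    rw [this (VectorField.mlieBracket 𝓘(ℝ, E) X Y x), this (X x), this (Y x)]
    simp
  set Z := frame E x i
  have hZ : SmoothAt Z x := smoothAt_frame (E := E) x i
  have key {X Y : Π x : M, TangentSpace 𝓘(ℝ, E) x} (hX : SmoothAt X x) (hY : SmoothAt Y x) :
      VectorField.mlieBracket 𝓘(ℝ, E) X (VectorField.mlieBracket 𝓘(ℝ, E) Y (f • Z)) x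
        = f x • VectorField.mlieBracket 𝓘(ℝ, E) X (VectorField.mlieBracket 𝓘(ℝ, E) Y Z) x
          + mvfderiv 𝓘(ℝ, E) f x (X x) • VectorField.mlieBracket 𝓘(ℝ, E) Y Z x
          + mvfderiv 𝓘(ℝ, E) f x (Y x) • VectorField.mlieBracket 𝓘(ℝ, E) X Z x
          + mvfderiv 𝓘(ℝ, E) (fun y ↦ mvfderiv 𝓘(ℝ, E) f y (Y y)) x (X x) • Z x := by
    have h1 : VectorField.mlieBracket 𝓘(ℝ, E) Y (f • Z) =ᶠ[𝓝 x]
        (fun y ↦ mvfderiv 𝓘(ℝ, E) f y (Y y)) • Z + f • VectorField.mlieBracket 𝓘(ℝ, E) Y Z := by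
      filter_upwards [eventually_mdifferentiableAt_of_smooth hf,
        hZ.eventually_mdifferentiableAt] with y hfy hZy
      exact VectorField.mlieBracket_smul_right hfy hZy
    have hD := hY.mvfderiv_apply hf
    have hB := hY.mlieBracket hZ
    rw [Filter.EventuallyEq.rfl.mlieBracket_vectorField_eq h1, VectorField.mlieBracket_add_right
      (SmoothAt.smul hD hZ).mdifferentiableAt (SmoothAt.smul hf hB).mdifferentiableAt,
      VectorField.mlieBracket_smul_right (hD.mdifferentiableAt (by simp)) hZ.mdifferentiableAt,
      VectorField.mlieBracket_smul_right (hf.mdifferentiableAt (by simp)) hB.mdifferentiableAt]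
    module
  have : IsManifold 𝓘(ℝ, E) (minSmoothness ℝ 3) M := by
    rw [minSmoothness_of_isRCLikeNormedField]
    exact IsManifold.of_le (n := ∞) ENat.LEInfty.out
  have smooth2 {X : Π x : M, TangentSpace 𝓘(ℝ, E) x} (hX : SmoothAt X x) :
      CMDiffAt (minSmoothness ℝ 2) (T% X) x := by
    rw [minSmoothness_of_isRCLikeNormedField]
    exact ContMDiffAt.of_le hX ENat.LEInfty.out
  -- Subtracting f times the Jacobi identity for X, Y, Z from the one for X, Y, fZ leaves a multiple
  -- of Z, whose coefficient is the claimed difference. It vanishes because Z does not.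
  have J := VectorField.leibniz_identity_mlieBracket_apply (smooth2 hX) (smooth2 hY)
    (smooth2 (.smul hf hZ))
  have J' := VectorField.leibniz_identity_mlieBracket_apply (smooth2 hX) (smooth2 hY) (smooth2 hZ)
  rw [key hX hY, key hY hX, J', VectorField.mlieBracket_smul_right (hf.mdifferentiableAt (by simp))
    hZ.mdifferentiableAt] at J
  have : (mvfderiv 𝓘(ℝ, E) f x (VectorField.mlieBracket 𝓘(ℝ, E) X Y x)
      - (mvfderiv 𝓘(ℝ, E) (fun y ↦ mvfderiv 𝓘(ℝ, E) f y (Y y)) x (X x)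
        - mvfderiv 𝓘(ℝ, E) (fun y ↦ mvfderiv 𝓘(ℝ, E) f y (X y)) x (Y x))) • Z x = 0 := by
    rw [sub_smul, sub_smul]
    have e := sub_eq_zero.2 J.symm
    rw [← e]
    module
  rcases smul_eq_zero.1 this with h | h
  · exact sub_eq_zero.1 h
  · exact absurd h (frame_ne_zero x i)

lemma contMDiffAt_det {ι : Type*} [Fintype ι] [DecidableEq ι] {A : M → Matrix ι ι ℝ} {x : M}
    (h : ∀ i j, CMDiffAt ∞ (fun y ↦ A y i j) x) : CMDiffAt ∞ (fun y ↦ (A y).det) x := by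
  simp only [Matrix.det_apply']
  exact contMDiffAt_finsetSum fun σ _ ↦
    contMDiffAt_const.mul (contMDiffAt_finsetProd fun i _ ↦ h _ _)

/-! ### Smoothness of the Levi-Civita covariant derivative. -/

namespace Metric

variable (g : Metric E M) {X Y Z : Π x : M, TangentSpace 𝓘(ℝ, E) x} {x : M}

lemma contMDiffAt_val (hX : SmoothAt X x) (hY : SmoothAt Y x) :
    CMDiffAt ∞ (fun y ↦ g.val y (X y) (Y y)) x := by
  have : ContMDiffAt 𝓘(ℝ, E) (𝓘(ℝ, E).prod 𝓘(ℝ)) ∞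
      (fun m ↦ Bundle.TotalSpace.mk' ℝ (E := Bundle.Trivial M ℝ) m (g.val m (X m) (Y m))) x := by
    apply ContMDiffAt.clm_bundle_apply₂ (F₁ := E) (F₂ := E)
    · exact g.contMDiff x
    · exact hX
    · exact hY
  rw [Bundle.contMDiffAt_totalSpace] at this
  exact this.2

lemma contMDiffAt_dVal (hX : SmoothAt X x) (hY : SmoothAt Y x) (hZ : SmoothAt Z x) :
    CMDiffAt ∞ (fun y ↦ g.dVal X Y y (Z y)) x :=
  hZ.mvfderiv_apply (g.contMDiffAt_val hX hY)

lemma contMDiffAt_koszul (hX : SmoothAt X x) (hY : SmoothAt Y x) (hZ : SmoothAt Z x) :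
    CMDiffAt ∞ (fun y ↦ g.koszul X Y Z y) x := by
  have h1 := g.contMDiffAt_dVal hY hZ hX
  have h2 := g.contMDiffAt_dVal hX hZ hY
  have h3 := g.contMDiffAt_dVal hX hY hZ
  have h4 := g.contMDiffAt_val (hX.mlieBracket hY) hZ
  have h5 := g.contMDiffAt_val (hX.mlieBracket hZ) hY
  have h6 := g.contMDiffAt_val (hY.mlieBracket hZ) hX
  exact ((((h1.add h2).sub h3).add h4).sub h5).sub h6

/-- The Gram matrix of the local frame at `x`. -/
def gram (x y : M) : Matrix (Fin (Module.finrank ℝ E)) (Fin (Module.finrank ℝ E)) ℝ :=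
  Matrix.of fun k j ↦ g.val y (frame E x j y) (frame E x k y)

/-- A vector in the kernel of the Gram matrix gives a combination of frame vectors orthogonal to the
whole frame, which nondegeneracy and independence of the frame exclude. -/
lemma det_gram_ne_zero (x : M) : (g.gram x x).det ≠ 0 := by
  intro h
  obtain ⟨v, hv, h0⟩ := Matrix.exists_mulVec_eq_zero_iff.2 h
  have hx := FiberBundle.mem_baseSet_trivializationAt' (F := E)
    (E := (TangentSpace 𝓘(ℝ, E) : M → Type _)) x
  have h1 : ∑ j, v j • frame E x j x = 0 := by
    refine g.nondegenerate x _ fun w ↦ ?_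
    rw [(eventually_eq_sum_frame (E := E) x).self_of_nhds w, map_sum]
    refine Finset.sum_eq_zero fun k _ ↦ ?_
    have := congrFun h0 k
    simp only [Matrix.mulVec, dotProduct, gram, Matrix.of_apply, Pi.zero_apply] at this
    rw [map_smul, map_sum, sum_apply]
    simp only [map_smul, smul_apply, smul_eq_mul]
    simp_rw [mul_comm (v _)]
    rw [this, mul_zero]
  apply hv
  simp only [frame, Bundle.Trivialization.localFrame_apply_of_mem_baseSet _ _ hx] at h1
  exact funext (Fintype.linearIndependent_iff.1 (Module.Basis.linearIndependent _) v h1)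

/-- A vector field is smooth if its products with a local frame are. -/
lemma smoothAt_of_val_frame {V : Π x : M, TangentSpace 𝓘(ℝ, E) x}
    (h : ∀ k, CMDiffAt ∞ (fun y ↦ g.val y (V y) (frame E x k y)) x) : SmoothAt V x := by
  have hG (k j) : CMDiffAt ∞ (fun y ↦ g.gram x y k j) x :=
    g.contMDiffAt_val (smoothAt_frame x j) (smoothAt_frame x k)
  let b (y : M) (k : Fin (Module.finrank ℝ E)) : ℝ := g.val y (V y) (frame E x k y)
  have hdet := contMDiffAt_det hG
  have hnum (j) : CMDiffAt ∞ (fun y ↦ ((g.gram x y).updateCol j (b y)).det) x := by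
    refine contMDiffAt_det fun k l ↦ ?_
    rcases eq_or_ne l j with rfl | hl
    · simpa using h k
    · simpa [Matrix.updateCol_ne hl] using hG k l
  -- Cramer's rule: near x these quotients are the frame coefficients of `V`.
  have hc (j) : CMDiffAt ∞ (fun y ↦ ((g.gram x y).updateCol j (b y)).det / (g.gram x y).det) x :=
    (hnum j).div₀ hdet (g.det_gram_ne_zero x)
  have hs := SmoothAt.sum (s := Finset.univ) fun j _ ↦ SmoothAt.smul (hc j) (smoothAt_frame x j)
  refine hs.congr ?_
  filter_upwards [eventually_eq_sum_frame (E := E) x,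
    hdet.continuousAt.eventually_ne (g.det_gram_ne_zero x)] with y hy hne
  have hb : b y = (g.gram x y).mulVec fun j ↦ frameCoeff E x j y (V y) := by
    ext k
    simp only [b, Matrix.mulVec, dotProduct, gram, Matrix.of_apply]
    conv_lhs => rw [hy (V y)]
    rw [map_sum, sum_apply]
    simp [mul_comm]
  rw [hy (V y)]
  refine Finset.sum_congr rfl fun j _ ↦ ?_
  have : ((g.gram x y).updateCol j (b y)).det
      = (g.gram x y).det * frameCoeff E x j y (V y) := by
    rw [← Matrix.cramer_apply, Matrix.cramer_eq_adjugate_mulVec, hb, Matrix.mulVec_mulVec,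
      Matrix.adjugate_mul, Matrix.smul_mulVec, Matrix.one_mulVec]
    rfl
  simp only [Pi.smul_apply', this]
  rw [mul_div_cancel_left₀ _ hne]

/-- The covariant derivative `∇_X Y`. -/
def nabla (X Y : Π x : M, TangentSpace 𝓘(ℝ, E) x) : Π x : M, TangentSpace 𝓘(ℝ, E) x :=
  fun y ↦ g.leviCivita Y y (X y)

/-- By the Koszul formula the products of ∇_X Y with the frame are smooth functions. -/
lemma smoothAt_nabla (hX : SmoothAt X x) (hY : SmoothAt Y x) : SmoothAt (g.nabla X Y) x := by
  refine g.smoothAt_of_val_frame fun k ↦ ?_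
  have h := (contMDiffAt_const (c := (2⁻¹ : ℝ))).mul
    (g.contMDiffAt_koszul hX hY (smoothAt_frame x k))
  refine h.congr_of_eventuallyEq ?_
  filter_upwards [hX.eventually_mdifferentiableAt, hY.eventually_mdifferentiableAt,
    (smoothAt_frame x k).eventually_mdifferentiableAt] with y hXy hYy hZy
  have := g.two_mul_val_leviCivitaFun hXy hYy hZy
  change g.val y (g.leviCivitaFun Y y (X y)) (frame E x k y) = 2⁻¹ * g.koszul X Y (frame E x k) y
  linarith

lemma nabla_add_right (hY : MDiffAt (T% Y) x) (hZ : MDiffAt (T% Z) x) :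
    g.nabla X (Y + Z) x = g.nabla X Y x + g.nabla X Z x := by
  simp [nabla, g.leviCivita.isCovariantDerivativeOnUniv.add hY hZ]

lemma nabla_smul_right {f : M → ℝ} (hf : MDiffAt f x) (hY : MDiffAt (T% Y) x) :
    g.nabla X (f • Y) x = f x • g.nabla X Y x + mvfderiv 𝓘(ℝ, E) f x (X x) • Y x := by
  simp [nabla, g.leviCivita.isCovariantDerivativeOnUniv.leibniz hY hf]

lemma nabla_add_left : g.nabla (X + Y) Z = g.nabla X Z + g.nabla Y Z := by
  ext y
  simp [nabla]

lemma nabla_smul_left {f : M → ℝ} : g.nabla (f • X) Y = f • g.nabla X Y := by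
  ext y
  simp [nabla]

lemma nabla_congr_right (hY : SmoothAt Y x) (h : ∀ᶠ y in 𝓝 x, Y y = Z y) :
    g.nabla X Y x = g.nabla X Z x := by
  rw [nabla, nabla, g.leviCivita.isCovariantDerivativeOnUniv.congr_of_eventuallyEq
    hY.mdifferentiableAt (hY.congr h).mdifferentiableAt Filter.univ_mem h]

end Metric

/-! ### Tensoriality over functions smooth at a point. -/

/-- An operation on vector fields which is linear over the functions that are smooth at `x`. -/
structure SmoothTensorialAt {A : Type*} [AddCommGroup A] [Module ℝ A]
    (Φ : (Π x : M, TangentSpace 𝓘(ℝ, E) x) → A) (x : M) : Prop where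
  smul : ∀ {f : M → ℝ} {X}, CMDiffAt ∞ f x → SmoothAt X x → Φ (f • X) = f x • Φ X
  add : ∀ {X Y}, SmoothAt X x → SmoothAt Y x → Φ (X + Y) = Φ X + Φ Y

namespace SmoothTensorialAt

variable {A : Type*} [AddCommGroup A] [Module ℝ A] {x : M}
  {Φ : (Π x : M, TangentSpace 𝓘(ℝ, E) x) → A}

/-- Multiplying by the indicator of the set where the fields agree identifies them. This function is
identically 1 near x, hence smooth at x; its behaviour elsewhere is irrelevant, so no bump function
is needed. -/
lemma eq_of_eventuallyEq (hΦ : SmoothTensorialAt Φ x) {X Y : Π x : M, TangentSpace 𝓘(ℝ, E) x}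
    (hX : SmoothAt X x) (h : ∀ᶠ y in 𝓝 x, X y = Y y) : Φ X = Φ Y := by
  classical
  have hY := hX.congr h
  let ψ (y : M) : ℝ := if X y = Y y then 1 else 0
  have hψx : ψ x = 1 := by simp [ψ, h.self_of_nhds]
  have this : ψ • X = ψ • Y := by
    funext y
    by_cases hy : X y = Y y <;> simp [ψ, hy]
  have hψ : CMDiffAt ∞ ψ x :=
    (contMDiffAt_const (c := (1 : ℝ))).congr_of_eventuallyEq (h.mono fun y hy ↦ by simp [ψ, hy])
  calc Φ X = Φ (ψ • X) := by rw [hΦ.smul hψ hX, hψx, one_smul]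
    _ = Φ (ψ • Y) := by rw [this]
    _ = Φ Y := by rw [hΦ.smul hψ hY, hψx, one_smul]

lemma sum (hΦ : SmoothTensorialAt Φ x) {ι : Type*} {s : Finset ι}
    {X : ι → Π x : M, TangentSpace 𝓘(ℝ, E) x} (hX : ∀ i, SmoothAt (X i) x) :
    Φ (fun y ↦ ∑ i ∈ s, X i y) = ∑ i ∈ s, Φ (X i) := by
  classical
  induction s using Finset.induction_on with
  | empty =>
    have := hΦ.smul (contMDiffAt_const (c := (0 : ℝ))) (SmoothAt.zero (x := x))
    simp only [Finset.sum_empty]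
    rw [zero_smul] at this
    rw [← this]
    congr 1
    funext y
    simp
  | insert a s ha h =>
    simp only [Finset.sum_insert ha, ← h]
    exact hΦ.add (hX a) (.sum fun i _ ↦ hX i)

/-- By locality the field may be replaced by its frame expansion, and linearity then leaves only the
coefficients at x. -/
lemma eq_of_eq (hΦ : SmoothTensorialAt Φ x) {X Y : Π x : M, TangentSpace 𝓘(ℝ, E) x}
    (hX : SmoothAt X x) (hY : SmoothAt Y x) (h : X x = Y x) : Φ X = Φ Y := by
  have key {X : Π x : M, TangentSpace 𝓘(ℝ, E) x} (hX : SmoothAt X x) :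
      Φ X = ∑ i, frameCoeff E x i x (X x) • Φ (frame E x i) := by
    rw [hΦ.eq_of_eventuallyEq (Y := fun y ↦ ∑ i, frameCoeff E x i y (X y) • frame E x i y) hX
      ((eventually_eq_sum_frame (E := E) x).mono fun y hy ↦ hy (X y))]
    rw [hΦ.sum (X := fun i y ↦ frameCoeff E x i y (X y) • frame E x i y)
      fun i ↦ .smul (frameCoeff_smooth hX i) (smoothAt_frame x i)]
    exact Finset.sum_congr rfl fun i _ ↦ hΦ.smul (frameCoeff_smooth hX i) (smoothAt_frame x i)
  rw [key hX, key hY, h]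

/-- The expansion matches the basis and the fields used to define `riemann`. -/
lemma eq_sum_coordField (hΦ : SmoothTensorialAt Φ x) {X : Π x : M, TangentSpace 𝓘(ℝ, E) x}
    (hX : SmoothAt X x) : Φ X = ∑ i, (Module.finBasis ℝ (TangentSpace 𝓘(ℝ, E) x)).repr (X x) i •
      Φ (Metric.coordField x i) := by
  have hs (i) : SmoothAt (Metric.coordField x i : Π y : M, TangentSpace 𝓘(ℝ, E) y) x :=
    SmoothAt.extend _
  let c (i : Fin (Module.finrank ℝ E)) : ℝ :=
    (Module.finBasis ℝ (TangentSpace 𝓘(ℝ, E) x)).repr (X x) i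
  have hc (i) : CMDiffAt ∞ (fun _ : M ↦ c i) x := contMDiffAt_const
  rw [hΦ.eq_of_eq (Y := fun y ↦ ∑ i, c i • Metric.coordField x i y) hX
    (.sum fun i _ ↦ SmoothAt.smul (hc i) (hs i)) ?_]
  · rw [hΦ.sum (X := fun i y ↦ c i • Metric.coordField x i y) fun i ↦ .smul (hc i) (hs i)]
    exact Finset.sum_congr rfl fun i _ ↦ hΦ.smul (hc i) (hs i)
  · simp only [Metric.coordField, FiberBundle.extend_apply_self]
    exact ((Module.finBasis ℝ (TangentSpace 𝓘(ℝ, E) x)).sum_repr (X x)).symm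

end SmoothTensorialAt

/-! ### The curvature of vector fields is a tensor. -/

namespace Metric

variable (g : Metric E M) {X Y Z W : Π x : M, TangentSpace 𝓘(ℝ, E) x} {x : M}

lemma curvature_eq_nabla : g.curvature X Y Z x
    = g.nabla (VectorField.mlieBracket 𝓘(ℝ, E) X Y) Z x
      - (g.nabla X (g.nabla Y Z) x - g.nabla Y (g.nabla X Z) x) := rfl

lemma curvature_swap : g.curvature X Y Z x = - g.curvature Y X Z x := by
  simp only [curvature_eq_nabla, VectorField.mlieBracket_swap (V := X) (W := Y)]
  simp only [nabla, Pi.neg_apply, map_neg]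
  abel

/-- The term -(Yf)∇_X Z coming from [fX,Y] cancels the Leibniz term of ∇_Y(f∇_X Z). -/
lemma curvature_tensorial_left (hZ : SmoothAt Z x) :
    SmoothTensorialAt (fun X ↦ g.curvature X Y Z x) x where
  smul {f X} hf hX := by
    simp only [curvature_eq_nabla]
    rw [g.nabla_smul_left, g.nabla_smul_left, g.nabla_smul_right (hf.mdifferentiableAt (by simp))
      (g.smoothAt_nabla hX hZ).mdifferentiableAt]
    simp only [nabla, VectorField.mlieBracket_smul_left (hf.mdifferentiableAt (by simp))
      hX.mdifferentiableAt, map_add, map_smul, Pi.smul_apply', neg_smul, map_neg]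
    module
  add {X X'} hX hX' := by
    simp only [curvature_eq_nabla]
    rw [g.nabla_add_left, g.nabla_add_left, g.nabla_add_right
      (g.smoothAt_nabla hX hZ).mdifferentiableAt (g.smoothAt_nabla hX' hZ).mdifferentiableAt]
    simp only [nabla, VectorField.mlieBracket_add_left hX.mdifferentiableAt
      hX'.mdifferentiableAt, map_add, Pi.add_apply]
    abel

lemma curvature_tensorial_mid (hZ : SmoothAt Z x) :
    SmoothTensorialAt (fun Y ↦ g.curvature X Y Z x) x where
  smul hf hY := by
    simp only [g.curvature_swap (X := X), (g.curvature_tensorial_left hZ).smul hf hY, smul_neg]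
  add hY hY' := by
    simp only [g.curvature_swap (X := X), (g.curvature_tensorial_left hZ).add hY hY', neg_add]

/-- The two first-order terms are together symmetric in X and Y, so they drop out of the commutator.
-/
lemma nabla_nabla_smul {f : M → ℝ} (hf : CMDiffAt ∞ f x) (hY : SmoothAt Y x)
    (hZ : SmoothAt Z x) : g.nabla X (g.nabla Y (f • Z)) x
      = f x • g.nabla X (g.nabla Y Z) x + mvfderiv 𝓘(ℝ, E) f x (X x) • g.nabla Y Z x
        + mvfderiv 𝓘(ℝ, E) f x (Y x) • g.nabla X Z x
        + mvfderiv 𝓘(ℝ, E) (fun y ↦ mvfderiv 𝓘(ℝ, E) f y (Y y)) x (X x) • Z x := by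
  have hD := hY.mvfderiv_apply hf
  have hN := g.smoothAt_nabla hY hZ
  rw [g.nabla_congr_right (Z := f • g.nabla Y Z + (fun y ↦ mvfderiv 𝓘(ℝ, E) f y (Y y)) • Z)
    (g.smoothAt_nabla hY (.smul hf hZ)) ?_,
    g.nabla_add_right (SmoothAt.smul hf hN).mdifferentiableAt
      (SmoothAt.smul hD hZ).mdifferentiableAt,
    g.nabla_smul_right (hf.mdifferentiableAt (by simp)) hN.mdifferentiableAt,
    g.nabla_smul_right (hD.mdifferentiableAt (by simp)) hZ.mdifferentiableAt]
  · module
  · filter_upwards [eventually_mdifferentiableAt_of_smooth hf,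
      hZ.eventually_mdifferentiableAt] with y hfy hZy
    exact g.nabla_smul_right hfy hZy

/-- Once the first-order terms are gone, the second derivatives of f cancel against [X,Y]f by
`mvfderiv_mlieBracket`. -/
lemma curvature_tensorial_right (hX : SmoothAt X x) (hY : SmoothAt Y x) :
    SmoothTensorialAt (fun Z ↦ g.curvature X Y Z x) x where
  smul {f Z} hf hZ := by
    simp only [curvature_eq_nabla]
    rw [g.nabla_nabla_smul hf hY hZ, g.nabla_nabla_smul hf hX hZ,
      g.nabla_smul_right (hf.mdifferentiableAt (by simp)) hZ.mdifferentiableAt,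
      mvfderiv_mlieBracket hf hX hY]
    module
  add {Z Z'} hZ hZ' := by
    have key {X Y : Π x : M, TangentSpace 𝓘(ℝ, E) x} (hY : SmoothAt Y x) :
        g.nabla X (g.nabla Y (Z + Z')) x
          = g.nabla X (g.nabla Y Z) x + g.nabla X (g.nabla Y Z') x := by
      rw [← g.nabla_add_right (g.smoothAt_nabla hY hZ).mdifferentiableAt
        (g.smoothAt_nabla hY hZ').mdifferentiableAt]
      refine g.nabla_congr_right (g.smoothAt_nabla hY (hZ.add hZ')) ?_
      filter_upwards [hZ.eventually_mdifferentiableAt, hZ'.eventually_mdifferentiableAt]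
        with y h h'
      exact g.nabla_add_right h h'
    simp only [curvature_eq_nabla]
    rw [key hY, key hX, g.nabla_add_right hZ.mdifferentiableAt hZ'.mdifferentiableAt]
    abel

/-- The curvature of smooth vector fields at a point is given by the curvature tensor. -/
theorem curvature_eq_riemann (hX : SmoothAt X x) (hY : SmoothAt Y x) (hZ : SmoothAt Z x) :
    g.curvature X Y Z x = g.riemann x (X x) (Y x) (Z x) := by
  have hs (i) : SmoothAt (coordField x i : Π y : M, TangentSpace 𝓘(ℝ, E) y) x :=
    SmoothAt.extend _
  rw [(g.curvature_tensorial_left hZ).eq_sum_coordField hX]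
  simp only [riemann, Module.Basis.constr_apply_fintype, LinearMap.sum_apply, LinearMap.smul_apply]
  refine Finset.sum_congr rfl fun i _ ↦ ?_
  congr 1
  rw [(g.curvature_tensorial_mid hZ).eq_sum_coordField hY]
  refine Finset.sum_congr rfl fun j _ ↦ ?_
  congr 1
  exact (g.curvature_tensorial_right (hs i) (hs j)).eq_sum_coordField hZ

end Metric

/-! ### Symmetries of the curvature and the Bianchi identities. -/

lemma mvfderiv_congr {f f' : M → ℝ} {x : M} (h : f =ᶠ[𝓝 x] f') :
    mvfderiv 𝓘(ℝ, E) f x = mvfderiv 𝓘(ℝ, E) f' x := by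
  ext v
  have : (mfderiv 𝓘(ℝ, E) 𝓘(ℝ) f x : E →L[ℝ] ℝ) = mfderiv 𝓘(ℝ, E) 𝓘(ℝ) f' x := h.mfderiv_eq
  exact congrArg (fun l : E →L[ℝ] ℝ ↦ l v) this

namespace Metric

variable (g : Metric E M) {X Y Z W : Π x : M, TangentSpace 𝓘(ℝ, E) x} {x : M}

lemma riemann_eq_curvature_extend (u v w : TangentSpace 𝓘(ℝ, E) x) :
    g.riemann x u v w = g.curvature (FiberBundle.extend E u) (FiberBundle.extend E v)
      (FiberBundle.extend E w) x := by
  rw [g.curvature_eq_riemann (.extend u) (.extend v) (.extend w)]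
  simp

lemma riemann_swap (u v w : TangentSpace 𝓘(ℝ, E) x) :
    g.riemann x u v w = - g.riemann x v u w := by
  rw [riemann_eq_curvature_extend, riemann_eq_curvature_extend, curvature_swap]

lemma nabla_sub_right (hY : SmoothAt Y x) (hZ : SmoothAt Z x) :
    g.nabla X (Y - Z) x = g.nabla X Y x - g.nabla X Z x := by
  rw [eq_sub_iff_add_eq, ← g.nabla_add_right (hY.sub hZ).mdifferentiableAt hZ.mdifferentiableAt,
    sub_add_cancel]

lemma nabla_sub_nabla (hX : MDiffAt (T% X) x) (hY : MDiffAt (T% Y) x) :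
    g.nabla X Y x - g.nabla Y X x = VectorField.mlieBracket 𝓘(ℝ, E) X Y x :=
  g.leviCivita_torsion hX hY

lemma jacobi (hX : SmoothAt X x) (hY : SmoothAt Y x) (hZ : SmoothAt Z x) :
    VectorField.mlieBracket 𝓘(ℝ, E) (VectorField.mlieBracket 𝓘(ℝ, E) X Y) Z x
      + VectorField.mlieBracket 𝓘(ℝ, E) (VectorField.mlieBracket 𝓘(ℝ, E) Y Z) X x
      + VectorField.mlieBracket 𝓘(ℝ, E) (VectorField.mlieBracket 𝓘(ℝ, E) Z X) Y x = 0 := by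
  have : IsManifold 𝓘(ℝ, E) (minSmoothness ℝ 3) M := by
    rw [minSmoothness_of_isRCLikeNormedField]
    exact IsManifold.of_le (n := ∞) ENat.LEInfty.out
  have smooth2 {X : Π x : M, TangentSpace 𝓘(ℝ, E) x} (hX : SmoothAt X x) :
      CMDiffAt (minSmoothness ℝ 2) (T% X) x := by
    rw [minSmoothness_of_isRCLikeNormedField]
    exact ContMDiffAt.of_le hX ENat.LEInfty.out
  have J := VectorField.leibniz_identity_mlieBracket_apply (smooth2 hX) (smooth2 hY) (smooth2 hZ)
  have h1 : VectorField.mlieBracket 𝓘(ℝ, E) (VectorField.mlieBracket 𝓘(ℝ, E) Z X) Y x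
      = VectorField.mlieBracket 𝓘(ℝ, E) Y (VectorField.mlieBracket 𝓘(ℝ, E) X Z) x := by
    rw [VectorField.mlieBracket_swap_apply, VectorField.mlieBracket_swap (V := Z) (W := X)]
    have := VectorField.mlieBracket_const_smul_right (I := 𝓘(ℝ, E)) (V := Y) (c := (-1 : ℝ))
      (hX.mlieBracket hZ).mdifferentiableAt
    rw [neg_one_smul, neg_one_smul] at this
    rw [this, neg_neg]
  rw [h1, VectorField.mlieBracket_swap_apply (V := VectorField.mlieBracket 𝓘(ℝ, E) Y Z), J]
  abel

/-- The first Bianchi identity. -/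
theorem riemann_bianchi (u v w : TangentSpace 𝓘(ℝ, E) x) :
    g.riemann x u v w + g.riemann x v w u + g.riemann x w u v = 0 := by
  simp only [riemann_eq_curvature_extend]
  set X := FiberBundle.extend E u
  set Y := FiberBundle.extend E v
  set Z := FiberBundle.extend E w
  have hX : SmoothAt X x := .extend u
  have hY : SmoothAt Y x := .extend v
  have hZ : SmoothAt Z x := .extend w
  -- Vanishing torsion, used twice: ∇_X∇_Y Z - ∇_X∇_Z Y is ∇_X[Y,Z], which is ∇_{[Y,Z]}X -
  -- [[Y,Z],X]. In the cyclic sum only the Jacobi expression survives.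
  have key {X Y Z : Π x : M, TangentSpace 𝓘(ℝ, E) x} (hX : SmoothAt X x) (hY : SmoothAt Y x)
      (hZ : SmoothAt Z x) : g.nabla X (g.nabla Y Z) x - g.nabla X (g.nabla Z Y) x
        = g.nabla (VectorField.mlieBracket 𝓘(ℝ, E) Y Z) X x
          - VectorField.mlieBracket 𝓘(ℝ, E) (VectorField.mlieBracket 𝓘(ℝ, E) Y Z) X x := by
    have h1 := g.smoothAt_nabla hY hZ
    have h2 := g.smoothAt_nabla hZ hY
    rw [← g.nabla_sub_nabla (hY.mlieBracket hZ).mdifferentiableAt hX.mdifferentiableAt,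
      sub_sub_cancel, ← g.nabla_sub_right h1 h2]
    refine g.nabla_congr_right (h1.sub h2) ?_
    filter_upwards [hY.eventually_mdifferentiableAt, hZ.eventually_mdifferentiableAt] with y h h'
    exact g.nabla_sub_nabla h h'
  have k1 := key hX hY hZ
  have k2 := key hY hZ hX
  have k3 := key hZ hX hY
  have J := jacobi hX hY hZ
  simp only [curvature_eq_nabla]
  calc _ = _ := ?_
    _ = _ := J
  rw [sub_eq_iff_eq_add] at k1 k2 k3
  rw [k1, k2, k3]
  abel

lemma mvfderiv_val (hX : MDiffAt (T% X) x) (hY : MDiffAt (T% Y) x) (hZ : MDiffAt (T% Z) x) :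
    mvfderiv 𝓘(ℝ, E) (fun y ↦ g.val y (Y y) (Z y)) x (X x)
      = g.val x (g.nabla X Y x) (Z x) + g.val x (Y x) (g.nabla X Z x) :=
  g.leviCivita_metric hX hY hZ

/-- The two mixed products are exchanged by swapping X and Y, hence cancel when [X,Y] acts on
g(Z,W). -/
lemma mvfderiv_mvfderiv_val (hX : SmoothAt X x) (hY : SmoothAt Y x) (hZ : SmoothAt Z x)
    (hW : SmoothAt W x) :
    mvfderiv 𝓘(ℝ, E) (fun y ↦ mvfderiv 𝓘(ℝ, E) (fun y ↦ g.val y (Z y) (W y)) y (Y y)) x (X x)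
      = g.val x (g.nabla X (g.nabla Y Z) x) (W x) + g.val x (g.nabla Y Z x) (g.nabla X W x)
        + (g.val x (g.nabla X Z x) (g.nabla Y W x)
          + g.val x (Z x) (g.nabla X (g.nabla Y W) x)) := by
  have h1 := g.smoothAt_nabla hY hZ
  have h2 := g.smoothAt_nabla hY hW
  have h : (fun y ↦ mvfderiv 𝓘(ℝ, E) (fun y ↦ g.val y (Z y) (W y)) y (Y y)) =ᶠ[𝓝 x]
      (fun y ↦ g.val y (g.nabla Y Z y) (W y)) + fun y ↦ g.val y (Z y) (g.nabla Y W y) := by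
    filter_upwards [hY.eventually_mdifferentiableAt, hZ.eventually_mdifferentiableAt,
      hW.eventually_mdifferentiableAt] with y h h' h''
    exact g.mvfderiv_val h h' h''
  rw [mvfderiv_congr h, mvfderiv_add (g.mdifferentiableAt_val h1.mdifferentiableAt hW.mdifferentiableAt)
    (g.mdifferentiableAt_val hZ.mdifferentiableAt h2.mdifferentiableAt), add_apply,
    g.mvfderiv_val hX.mdifferentiableAt h1.mdifferentiableAt hW.mdifferentiableAt,
    g.mvfderiv_val hX.mdifferentiableAt hZ.mdifferentiableAt h2.mdifferentiableAt]

/-- The curvature endomorphisms are skew-symmetric. -/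
theorem val_riemann_skew (u v w z : TangentSpace 𝓘(ℝ, E) x) :
    g.val x (g.riemann x u v w) z = - g.val x w (g.riemann x u v z) := by
  simp only [riemann_eq_curvature_extend]
  set X := FiberBundle.extend E u
  set Y := FiberBundle.extend E v
  set Z := FiberBundle.extend E w with hZ'
  set W := FiberBundle.extend E z with hW'
  have hX : SmoothAt X x := .extend u
  have hY : SmoothAt Y x := .extend v
  have hZ : SmoothAt Z x := .extend w
  have hW : SmoothAt W x := .extend z
  have hZx : Z x = w := FiberBundle.extend_apply_self ..
  have hWx : W x = z := FiberBundle.extend_apply_self ..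
  rw [← hZx, ← hWx]
  have h := mvfderiv_mlieBracket (g.contMDiffAt_val hZ hW) hX hY
  rw [g.mvfderiv_mvfderiv_val hX hY hZ hW, g.mvfderiv_mvfderiv_val hY hX hZ hW,
    g.mvfderiv_val (hX.mlieBracket hY).mdifferentiableAt hZ.mdifferentiableAt
      hW.mdifferentiableAt] at h
  simp only [curvature_eq_nabla, map_sub, sub_apply]
  linarith

/-- The pair symmetry of the curvature. -/
theorem val_riemann_pair (u v w z : TangentSpace 𝓘(ℝ, E) x) :
    g.val x (g.riemann x u v w) z = g.val x (g.riemann x w z u) v := by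
  have B (a b c d : TangentSpace 𝓘(ℝ, E) x) : g.val x (g.riemann x a b c) d
      + g.val x (g.riemann x b c a) d + g.val x (g.riemann x c a b) d = 0 := by
    rw [← add_apply, ← map_add, ← add_apply, ← map_add, g.riemann_bianchi]
    simp
  have S (a b c d : TangentSpace 𝓘(ℝ, E) x) :
      g.val x (g.riemann x a b c) d = - g.val x (g.riemann x a b d) c := by
    rw [val_riemann_skew, g.symm]
  have A (a b c d : TangentSpace 𝓘(ℝ, E) x) :
      g.val x (g.riemann x a b c) d = - g.val x (g.riemann x b a c) d := by
    rw [riemann_swap]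
    simp
  -- The octahedron argument: the four first Bianchi identities on u, v, w, z, combined by the two
  -- skew symmetries.
  have b1 := B u v w z
  have b2 := B v w z u
  have b3 := B w z u v
  have b4 := B z u v w
  have s1 := S v w z u
  have s2 := S z v w u
  have s3 := S w z v u
  have s4 := S z u w v
  have s5 := S z u v w
  have s6 := S u v z w
  have s7 := S u w z v
  have s8 := S w z u v
  have s9 := S u v w z
  have s10 := S v z u w
  have a1 := A w u v z
  have a2 := A u w z v
  have a3 := A v z u w
  have a4 := A z v w u
  have s11 := S w u v z
  have s12 := S v z w u
  linarith

/-- The second Bianchi identity. -/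
theorem curvature_bianchi (hX : SmoothAt X x) (hY : SmoothAt Y x) (hZ : SmoothAt Z x)
    (hW : SmoothAt W x) :
    g.nabla X (g.curvature Y Z W) x - g.curvature Y Z (g.nabla X W) x
      + (g.nabla Y (g.curvature Z X W) x - g.curvature Z X (g.nabla Y W) x)
      + (g.nabla Z (g.curvature X Y W) x - g.curvature X Y (g.nabla Z W) x)
    = g.curvature (VectorField.mlieBracket 𝓘(ℝ, E) Y Z) X W x
      + g.curvature (VectorField.mlieBracket 𝓘(ℝ, E) Z X) Y W x
      + g.curvature (VectorField.mlieBracket 𝓘(ℝ, E) X Y) Z W x := by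
  have key {X Y Z : Π x : M, TangentSpace 𝓘(ℝ, E) x} (hY : SmoothAt Y x) (hZ : SmoothAt Z x) :
      g.nabla X (g.curvature Y Z W) x = g.nabla X (g.nabla (VectorField.mlieBracket 𝓘(ℝ, E) Y Z) W) x
        - (g.nabla X (g.nabla Y (g.nabla Z W)) x - g.nabla X (g.nabla Z (g.nabla Y W)) x) := by
    have h1 := g.smoothAt_nabla (hY.mlieBracket hZ) hW
    have h2 := g.smoothAt_nabla hY (g.smoothAt_nabla hZ hW)
    have h3 := g.smoothAt_nabla hZ (g.smoothAt_nabla hY hW)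
    rw [← g.nabla_sub_right h2 h3, ← g.nabla_sub_right h1 (h2.sub h3)]
    rfl
  -- Expanding the curvatures, the triple derivatives and the mixed terms such as ∇_X∇_{[Y,Z]}W
  -- cancel; what is left is, up to sign, ∇W evaluated on the Jacobi sum.
  have J := congrArg (g.leviCivita W x) (jacobi hX hY hZ)
  rw [map_add, map_add, map_zero] at J
  change g.nabla (VectorField.mlieBracket 𝓘(ℝ, E) (VectorField.mlieBracket 𝓘(ℝ, E) X Y) Z) W x
      + g.nabla (VectorField.mlieBracket 𝓘(ℝ, E) (VectorField.mlieBracket 𝓘(ℝ, E) Y Z) X) W x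
      + g.nabla (VectorField.mlieBracket 𝓘(ℝ, E) (VectorField.mlieBracket 𝓘(ℝ, E) Z X) Y) W x
      = 0 at J
  rw [key hY hZ, key hZ hX, key hX hY]
  simp only [curvature_eq_nabla]
  rw [← sub_eq_zero]
  calc _ = _ := ?_
    _ = - _ := congrArg (- ·) J
    _ = 0 := neg_zero
  abel

end Metric

/-! ### The Ricci operator under semi-symmetry. -/

namespace Metric

variable (g : Metric E M) {x : M}

lemma eq_of_val_eq {u v : TangentSpace 𝓘(ℝ, E) x} (h : ∀ w, g.val x u w = g.val x v w) :
    u = v := by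
  rw [← sub_eq_zero]
  refine g.nondegenerate x _ fun w ↦ ?_
  rw [map_sub, sub_apply, h, sub_self]

lemma val_ricci (u v : TangentSpace 𝓘(ℝ, E) x) :
    g.val x (g.ricci x u) v = LinearMap.trace ℝ _ ((g.riemann x u).flip v) :=
  g.val_flat_symm x _ v

/-- The musical isomorphism conjugates the transpose of `T` to `S`. -/
lemma trace_eq_of_adjoint {S T : Module.End ℝ (TangentSpace 𝓘(ℝ, E) x)}
    (h : ∀ u v, g.val x (S u) v = g.val x u (T v)) :
    LinearMap.trace ℝ _ S = LinearMap.trace ℝ _ T := by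
  have hS : S = (g.flat x).symm.conj (Module.Dual.transpose (R := ℝ) T) := by
    ext u
    refine g.eq_of_val_eq fun w ↦ ?_
    rw [h, LinearEquiv.conj_apply]
    exact (g.val_flat_symm x (Module.Dual.transpose (R := ℝ) T (g.flat x u)) w).symm
  rw [hS, LinearMap.trace_conj', LinearMap.trace_transpose']

/-- The Ricci operator is self-adjoint. -/
theorem val_ricci_comm (u v : TangentSpace 𝓘(ℝ, E) x) :
    g.val x (g.ricci x u) v = g.val x u (g.ricci x v) := by
  rw [g.symm x u, val_ricci, val_ricci]
  -- Pair symmetry makes a ↦ R(u,a)v and a ↦ R(v,a)u adjoint to each other.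
  refine g.trace_eq_of_adjoint fun a b ↦ ?_
  rw [LinearMap.flip_apply, LinearMap.flip_apply, val_riemann_pair, g.symm]

lemma commute_aeval {V : Type*} [AddCommGroup V] [Module ℝ V] {A L : Module.End ℝ V}
    (h : Commute A L) (p : Polynomial ℝ) : Commute (Polynomial.aeval A p) L := by
  induction p using Polynomial.induction_on' with
  | add p q hp hq => rw [map_add]; exact hp.add_left hq
  | monomial n a =>
    rw [Polynomial.aeval_monomial]
    exact Commute.mul_left (Algebra.commutes a L) (h.pow_left n)

lemma val_aeval_ricci_comm (p : Polynomial ℝ) (u v : TangentSpace 𝓘(ℝ, E) x) :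
    g.val x (Polynomial.aeval (g.ricci x) p u) v
      = g.val x u (Polynomial.aeval (g.ricci x) p v) := by
  induction p using Polynomial.induction_on' generalizing u v with
  | add p q hp hq => simp [hp, hq]
  | monomial n a =>
    rw [Polynomial.aeval_monomial, Module.End.mul_apply, Module.End.mul_apply,
      Module.algebraMap_end_apply, Module.algebraMap_end_apply, map_smul, map_smul, smul_apply]
    congr 1
    induction n generalizing u with
    | zero => simp
    | succ n ih =>
      rw [pow_succ, Module.End.mul_apply, ih, val_ricci_comm, ← Module.End.mul_apply,
        ← pow_succ', pow_succ]

variable {g}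

/-- On a semi-symmetric manifold, the curvature endomorphisms commute with the Ricci operator. -/
theorem IsSemiSymmetric.riemann_ricci (hg : g.IsSemiSymmetric) (u v w : TangentSpace 𝓘(ℝ, E) x) :
    g.riemann x u v (g.ricci x w) = g.ricci x (g.riemann x u v w) := by
  refine g.eq_of_val_eq fun t ↦ ?_
  rw [val_riemann_skew, val_ricci, val_ricci, ← add_eq_zero_iff_neg_eq, ← map_add]
  -- Semi-symmetry read as an identity of operators in a: the right side is a commutator, hence
  -- traceless.
  have : (g.riemann x w).flip (g.riemann x u v t) + (g.riemann x (g.riemann x u v w)).flip t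
      = g.riemann x u v * (g.riemann x w).flip t - (g.riemann x w).flip t * g.riemann x u v := by
    ext a
    have := LinearMap.congr_fun (hg x u v w a) t
    simp only [LinearMap.add_apply, LinearMap.sub_apply, LinearMap.comp_apply] at this
    simp only [LinearMap.add_apply, LinearMap.sub_apply, LinearMap.flip_apply,
      Module.End.mul_apply]
    rw [← sub_eq_zero] at this ⊢
    rw [← neg_eq_zero, ← this]
    abel
  rw [this, map_sub, LinearMap.trace_mul_comm, sub_self]

/-- Pair symmetry turns the claim into g(R(w,t)Ric u, v) = g(R(w,t)u, Ric v), where commutation and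
self-adjointness apply. -/
lemma IsSemiSymmetric.riemann_ricci_left_eq_mid (hg : g.IsSemiSymmetric)
    (u v w : TangentSpace 𝓘(ℝ, E) x) :
    g.riemann x (g.ricci x u) v w = g.riemann x u (g.ricci x v) w := by
  refine g.eq_of_val_eq fun t ↦ ?_
  rw [val_riemann_pair, hg.riemann_ricci, val_ricci_comm, ← val_riemann_pair]

/-- The defect `T` is skew in its first two arguments and, by the first Bianchi identity, symmetric
in its last two. Such a trilinear map equals its own negative. -/
lemma IsSemiSymmetric.riemann_ricci_left (hg : g.IsSemiSymmetric)
    (u v w : TangentSpace 𝓘(ℝ, E) x) :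
    g.riemann x (g.ricci x u) v w = g.ricci x (g.riemann x u v w) := by
  let T (u v w : TangentSpace 𝓘(ℝ, E) x) :=
    g.riemann x (g.ricci x u) v w - g.ricci x (g.riemann x u v w)
  have h1 (u v w : TangentSpace 𝓘(ℝ, E) x) : T u v w = - T v u w := by
    simp only [T]
    rw [hg.riemann_ricci_left_eq_mid, g.riemann_swap, g.riemann_swap u v, map_neg]
    abel
  have h2 (u v w : TangentSpace 𝓘(ℝ, E) x) : T u v w = T u w v := by
    have b1 := g.riemann_bianchi (g.ricci x u) v w
    have b2 := congrArg (g.ricci x) (g.riemann_bianchi u v w)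
    rw [map_add, map_add, map_zero] at b2
    rw [hg.riemann_ricci, g.riemann_swap w] at b1
    rw [g.riemann_swap w, map_neg] at b2
    simp only [T]
    rw [← sub_eq_zero]
    calc _ = _ := ?_
      _ = _ - _ := congrArg₂ (· - ·) b1 b2
      _ = 0 := sub_zero _
    abel
  have h3 : T u v w = - T u v w := by
    calc T u v w = - T v u w := h1 ..
      _ = - T v w u := by rw [h2]
      _ = T w v u := by rw [h1, neg_neg]
      _ = T w u v := h2 ..
      _ = - T u w v := h1 ..
      _ = - T u v w := by rw [h2]
  have h4 : (2 : ℝ) • T u v w = 0 := by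
    rw [two_smul]
    nth_rewrite 2 [h3]
    exact add_neg_cancel _
  exact sub_eq_zero.1 ((smul_eq_zero.1 h4).resolve_left two_ne_zero)

lemma IsSemiSymmetric.riemann_aeval_right (hg : g.IsSemiSymmetric) (p : Polynomial ℝ)
    (u v w : TangentSpace 𝓘(ℝ, E) x) :
    g.riemann x u v (Polynomial.aeval (g.ricci x) p w)
    = Polynomial.aeval (g.ricci x) p (g.riemann x u v w) := by
  have : Commute (g.ricci x) (g.riemann x u v) := by
    ext w
    exact (hg.riemann_ricci u v w).symm
  exact (LinearMap.congr_fun (commute_aeval this p) w).symm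

lemma IsSemiSymmetric.riemann_aeval_left (hg : g.IsSemiSymmetric) (p : Polynomial ℝ)
    (u v w : TangentSpace 𝓘(ℝ, E) x) :
    g.riemann x (Polynomial.aeval (g.ricci x) p u) v w
    = Polynomial.aeval (g.ricci x) p (g.riemann x u v w) := by
  have : Commute (g.ricci x) (((g.riemann x).flip v).flip w) := by
    ext u
    exact (hg.riemann_ricci_left u v w).symm
  exact (LinearMap.congr_fun (commute_aeval this p) u).symm

lemma IsSemiSymmetric.riemann_aeval_mid (hg : g.IsSemiSymmetric) (p : Polynomial ℝ)
    (u v w : TangentSpace 𝓘(ℝ, E) x) :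
    g.riemann x u (Polynomial.aeval (g.ricci x) p v) w
    = Polynomial.aeval (g.ricci x) p (g.riemann x u v w) := by
  rw [g.riemann_swap, hg.riemann_aeval_left, g.riemann_swap v, map_neg, neg_neg]

/-- A nilpotent polynomial in the Ricci operator is annihilated by the Ricci operator. -/
theorem IsSemiSymmetric.aeval_X_mul_eq_zero (hg : g.IsSemiSymmetric) {q : Polynomial ℝ}
    (hq : IsNilpotent (Polynomial.aeval (g.ricci x) q)) :
    Polynomial.aeval (g.ricci x) (Polynomial.X * q) = 0 := by
  ext u
  refine g.nondegenerate x _ fun v ↦ ?_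
  rw [map_mul, Polynomial.aeval_X, Module.End.mul_apply, val_ricci]
  have h1 : (g.riemann x (Polynomial.aeval (g.ricci x) q u)).flip v
      = Polynomial.aeval (g.ricci x) q * (g.riemann x u).flip v := by
    ext a
    exact hg.riemann_aeval_left ..
  have h2 : Commute (Polynomial.aeval (g.ricci x) q) ((g.riemann x u).flip v) := by
    ext a
    exact (hg.riemann_aeval_mid ..).symm
  rw [h1]
  exact (LinearMap.isNilpotent_trace_of_isNilpotent (h2.isNilpotent_mul_right hq)).eq_zero

/-- A vector in the kernel of the curvature is in the kernel of the Ricci operator. -/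
lemma ricci_eq_zero_of_riemann {u : TangentSpace 𝓘(ℝ, E) x} (h : ∀ v w, g.riemann x v w u = 0) :
    g.ricci x u = 0 := by
  refine g.nondegenerate x _ fun v ↦ ?_
  rw [val_ricci]
  have : (g.riemann x u).flip v = 0 := by
    ext a
    refine g.nondegenerate x _ fun t ↦ ?_
    rw [LinearMap.flip_apply, val_riemann_pair, h]
    simp
  rw [this, map_zero]

end Metric

/-! ### Kernels of polynomials in the Ricci operator. -/

open Polynomial

/-- Each irreducible factor of m, counted with multiplicity, costs one power of q; normalizing makes
the factor monic. -/
lemma exists_dvd_pow_of_irreducible_dvd {m q : ℝ[X]} (hm : m ≠ 0)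
    (h : ∀ p : ℝ[X], p.Monic → Irreducible p → p ∣ m → p ∣ q) : ∃ n, m ∣ q ^ n := by
  induction m using WfDvdMonoid.induction_on_irreducible with
  | zero => exact absurd rfl hm
  | unit u hu => exact ⟨0, hu.dvd⟩
  | mul m p hm' hp ih =>
    obtain ⟨n, hn⟩ := ih hm' fun p' h1 h2 h3 ↦ h p' h1 h2 (h3.mul_left _)
    refine ⟨n + 1, ?_⟩
    rw [pow_succ']
    refine mul_dvd_mul ?_ hn
    have ha : Associated p (normalize p) := (normalize_associated p).symm
    exact ha.dvd.trans (h _ (monic_normalize hp.ne_zero) (ha.irreducible hp)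
      (ha.symm.dvd.trans (dvd_mul_right _ _)))

lemma isCoprime_of_monic_irreducible {p q : ℝ[X]} (hp : p.Monic) (hp' : Irreducible p)
    (hq : q.Monic) (hq' : Irreducible q) (h : p ≠ q) : IsCoprime p q := by
  rw [hp'.coprime_iff_not_dvd]
  intro hd
  exact h (eq_of_monic_of_associated hp hq (hp'.associated_of_dvd hq' hd))

/-- The product of `X ^ 2` and the polynomials `P k`, `k ∈ S`. -/
def factorProd {r : ℕ} (P : Fin r → M → ℝ[X]) (S : Finset (Fin r)) (x : M) : ℝ[X] :=
  X ^ 2 * ∏ k ∈ S, P k x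

namespace Metric

variable {g : Metric E M} {U : Set M} {r : ℕ} {P : Fin r → M → ℝ[X]} {x : M}

/-- The sum of `V₀` and of the spaces `ker P k (Ric)`, `k ≠ i`, as the kernel of a polynomial in
the Ricci operator. -/
def complKer (g : Metric E M) (P : Fin r → M → ℝ[X]) (i : Fin r) (x : M) :
    Submodule ℝ (TangentSpace 𝓘(ℝ, E) x) :=
  g.kerRicci (factorProd P (Finset.univ.erase i)) x

lemma mem_kerRicci {Q : M → ℝ[X]} {v : TangentSpace 𝓘(ℝ, E) x} :
    v ∈ g.kerRicci Q x ↔ aeval (g.ricci x) (Q x) v = 0 := Iff.rfl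

lemma V₀_eq_kerRicci : g.V₀ x = g.kerRicci (factorProd P ∅) x := by
  simp [V₀, kerRicci, factorProd]

lemma kerRicci_mono {Q Q' : M → ℝ[X]} (h : Q x ∣ Q' x) : g.kerRicci Q x ≤ g.kerRicci Q' x := by
  intro v hv
  obtain ⟨c, hc⟩ := h
  rw [mem_kerRicci] at hv ⊢
  rw [hc, mul_comm, map_mul, Module.End.mul_apply, hv, map_zero]

lemma V₀_le_complKer (i : Fin r) : g.V₀ x ≤ g.complKer P i x := by
  rw [V₀_eq_kerRicci (P := P)]
  exact kerRicci_mono (mul_dvd_mul_left _ (by simp))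

lemma kerRicci_le_complKer {i j : Fin r} (h : i ≠ j) :
    g.kerRicci (P i) x ≤ g.complKer P j x :=
  kerRicci_mono ((Finset.dvd_prod_of_mem (fun k ↦ P k x) (by simpa using h)).mul_left _)

namespace IsRicciFactorFamily

lemma monic (hP : g.IsRicciFactorFamily U P) (hx : x ∈ U) (i : Fin r) : (P i x).Monic :=
  ((hP.factors x hx _).1 ⟨i, rfl⟩).1

lemma irreducible (hP : g.IsRicciFactorFamily U P) (hx : x ∈ U) (i : Fin r) :
    Irreducible (P i x) :=
  ((hP.factors x hx _).1 ⟨i, rfl⟩).2.1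

lemma isCoprime_X (hP : g.IsRicciFactorFamily U P) (hx : x ∈ U) (i : Fin r) :
    IsCoprime (P i x) X :=
  isCoprime_of_monic_irreducible (hP.monic hx i) (hP.irreducible hx i) monic_X irreducible_X
    ((hP.factors x hx _).1 ⟨i, rfl⟩).2.2.1

lemma isCoprime_factorProd (hP : g.IsRicciFactorFamily U P) (hx : x ∈ U) {i : Fin r}
    {S : Finset (Fin r)} (hi : i ∉ S) : IsCoprime (P i x) (factorProd P S x) := by
  refine (hP.isCoprime_X hx i).pow_right.mul_right (IsCoprime.prod_right fun k hk ↦ ?_)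
  refine isCoprime_of_monic_irreducible (hP.monic hx i) (hP.irreducible hx i) (hP.monic hx k)
    (hP.irreducible hx k) fun h ↦ hi ?_
  rwa [hP.injective x hx h]

/-- A bound uniform in the point, so that P_i(Ric) is a sum over a fixed range when its smoothness
is proved. -/
lemma natDegree_le (hP : g.IsRicciFactorFamily U P) (hx : x ∈ U) (i : Fin r) :
    (P i x).natDegree ≤ Module.finrank ℝ E := by
  have h1 := ((hP.factors x hx _).1 ⟨i, rfl⟩).2.2.2
  have h2 : P i x ∣ (g.ricci x).charpoly := h1.trans (LinearMap.minpoly_dvd_charpoly _)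
  have h3 := natDegree_le_of_dvd h2 (LinearMap.charpoly_monic _).ne_zero
  rwa [LinearMap.charpoly_natDegree] at h3

/-- The multiplicity of the irreducible factors of the minimal polynomial of the Ricci operator is
one for the factors other than `X`, and at most two for `X`. -/
lemma aeval_factorProd_univ (hg : g.IsSemiSymmetric) (hP : g.IsRicciFactorFamily U P)
    (hx : x ∈ U) : aeval (g.ricci x) (factorProd P Finset.univ x) = 0 := by
  have hm : minpoly ℝ (g.ricci x) ≠ 0 := minpoly.ne_zero (Algebra.IsIntegral.isIntegral _)
  obtain ⟨n, hn⟩ := exists_dvd_pow_of_irreducible_dvd (q := X * ∏ k, P k x) hm fun p h1 h2 h3 ↦ by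
    by_cases hpX : p = X
    · rw [hpX]
      exact dvd_mul_right _ _
    · obtain ⟨i, rfl⟩ := (hP.factors x hx p).2 ⟨h1, h2, hpX, h3⟩
      exact (Finset.dvd_prod_of_mem (fun k ↦ P k x) (Finset.mem_univ i)).mul_left _
  -- X ∏ P_k has every irreducible factor of the minimal polynomial, so it is nilpotent at Ric; one
  -- more X annihilates, which produces X².
  have h := hg.aeval_X_mul_eq_zero (q := X * ∏ k, P k x)
    ⟨n, by rw [← map_pow]; exact (minpoly.dvd_iff).1 hn⟩
  rwa [← mul_assoc, ← pow_two] at h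

lemma aeval_mul_complKer (hg : g.IsSemiSymmetric) (hP : g.IsRicciFactorFamily U P)
    (hx : x ∈ U) (i : Fin r) :
    aeval (g.ricci x) (P i x * factorProd P (Finset.univ.erase i) x) = 0 := by
  have h := hP.aeval_factorProd_univ hg hx
  rw [factorProd, ← Finset.mul_prod_erase _ _ (Finset.mem_univ i), mul_left_comm] at h
  exact h

lemma mem_kerRicci_erase (hP : g.IsRicciFactorFamily U P) (hx : x ∈ U) {j : Fin r}
    {T : Finset (Fin r)} (hj : j ∈ T) {v : TangentSpace 𝓘(ℝ, E) x}
    (hv : v ∈ g.kerRicci (factorProd P T) x) (hv' : v ∈ g.complKer P j x) :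
    v ∈ g.kerRicci (factorProd P (T.erase j)) x := by
  obtain ⟨a, b, hab⟩ := hP.isCoprime_factorProd hx (Finset.notMem_erase j Finset.univ)
  rw [complKer, mem_kerRicci] at hv'
  rw [mem_kerRicci] at hv ⊢
  -- The Bézout relation between P_j and the product defining K_j, multiplied by the polynomial on
  -- the left.
  have : factorProd P (T.erase j) x = a * factorProd P T x
      + (b * factorProd P (T.erase j) x) * factorProd P (Finset.univ.erase j) x := by
    have hT : factorProd P T x = P j x * factorProd P (T.erase j) x := by
      rw [factorProd, ← Finset.mul_prod_erase _ _ hj, mul_left_comm]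
      rfl
    linear_combination -(factorProd P (T.erase j) x) * hab - a * hT
  rw [this, map_add, map_mul, map_mul _ (b * _), LinearMap.add_apply, Module.End.mul_apply,
    Module.End.mul_apply, hv, hv', map_zero, map_zero, add_zero]

/-- The full product kills every vector, and each membership in some K_j allows the factor P_j to be
dropped. -/
lemma mem_kerRicci_compl (hg : g.IsSemiSymmetric) (hP : g.IsRicciFactorFamily U P) (hx : x ∈ U)
    {S : Finset (Fin r)} {v : TangentSpace 𝓘(ℝ, E) x} (hv : ∀ j ∈ S, v ∈ g.complKer P j x) :
    v ∈ g.kerRicci (factorProd P (Finset.univ \ S)) x := by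
  induction S using Finset.induction_on with
  | empty =>
    rw [Finset.sdiff_empty, mem_kerRicci, hP.aeval_factorProd_univ hg hx, LinearMap.zero_apply]
  | insert j S hj ih =>
    have h1 := ih fun k hk ↦ hv k (Finset.mem_insert_of_mem hk)
    rw [Finset.sdiff_insert]
    exact hP.mem_kerRicci_erase hx (by simpa using hj) h1 (hv j (Finset.mem_insert_self j S))

lemma mem_V₀ (hg : g.IsSemiSymmetric) (hP : g.IsRicciFactorFamily U P) (hx : x ∈ U)
    {v : TangentSpace 𝓘(ℝ, E) x} (hv : ∀ j, v ∈ g.complKer P j x) : v ∈ g.V₀ x := by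
  have := hP.mem_kerRicci_compl hg hx (S := Finset.univ) fun j _ ↦ hv j
  rwa [Finset.sdiff_self, ← V₀_eq_kerRicci] at this

/-- Dropping every factor except P_i leaves ker(X² P_i)(Ric), which splits because X² and P_i are
coprime. -/
lemma mem_V₀_sup (hg : g.IsSemiSymmetric) (hP : g.IsRicciFactorFamily U P) (hx : x ∈ U)
    {i : Fin r} {v : TangentSpace 𝓘(ℝ, E) x} (hv : ∀ j ≠ i, v ∈ g.complKer P j x) :
    v ∈ g.V₀ x ⊔ g.kerRicci (P i) x := by
  have h := hP.mem_kerRicci_compl hg hx (S := Finset.univ.erase i)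
    fun j hj ↦ hv j (Finset.ne_of_mem_erase hj)
  have hS : (Finset.univ \ Finset.univ.erase i : Finset (Fin r)) = {i} := by
    ext j
    simp
  have hc : IsCoprime (X ^ 2 : ℝ[X]) (P i x) := (hP.isCoprime_X hx i).pow_right.symm
  have h2 := sup_ker_aeval_eq_ker_aeval_mul_of_coprime (g.ricci x) hc
  rw [map_pow, aeval_X] at h2
  rw [hS, mem_kerRicci, factorProd, Finset.prod_singleton] at h
  rw [V₀, kerRicci, h2]
  exact h

end IsRicciFactorFamily

/-- By Bézout, u is in the image of q(Ric), and q(Ric) is self-adjoint. -/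
lemma val_eq_zero_of_kerRicci {p q : M → ℝ[X]} (h : IsCoprime (p x) (q x))
    {u v : TangentSpace 𝓘(ℝ, E) x} (hu : u ∈ g.kerRicci p x) (hv : v ∈ g.kerRicci q x) :
    g.val x u v = 0 := by
  obtain ⟨a, b, hab⟩ := h
  rw [mem_kerRicci] at hu hv
  have hu' : u = aeval (g.ricci x) (q x * b) u := by
    have := LinearMap.congr_fun (congrArg (aeval (g.ricci x)) hab) u
    rw [map_add, map_mul, LinearMap.add_apply, Module.End.mul_apply, hu, map_zero, zero_add,
      map_one, Module.End.one_apply, mul_comm] at this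
    exact this.symm
  rw [hu', mul_comm, val_aeval_ricci_comm, map_mul, Module.End.mul_apply, hv, map_zero, map_zero]

lemma eq_zero_of_kerRicci {p q : M → ℝ[X]} (h : IsCoprime (p x) (q x))
    {u : TangentSpace 𝓘(ℝ, E) x} (hu : u ∈ g.kerRicci p x) (hv : u ∈ g.kerRicci q x) : u = 0 := by
  exact Submodule.disjoint_def.1 (disjoint_ker_aeval_of_isCoprime (g.ricci x) h) u hu hv

end Metric

/-! ### Total geodesy of K_i and parallelism of V_i along it. -/

/-- Smoothness of a vector field in a neighbourhood of a point. -/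
def SmoothNear (X : Π x : M, TangentSpace 𝓘(ℝ, E) x) (x : M) : Prop := ∀ᶠ y in 𝓝 x, SmoothAt X y

lemma SmoothNear.smoothAt {X : Π x : M, TangentSpace 𝓘(ℝ, E) x} {x : M} (h : SmoothNear X x) :
    SmoothAt X x := h.self_of_nhds

namespace Metric

variable (g : Metric E M) {U : Set M} {r : ℕ} {P : Fin r → M → ℝ[X]} {x : M}
  {X Y Z W : Π x : M, TangentSpace 𝓘(ℝ, E) x}

/-- The products with the frame are traces, hence sums of frame coefficients of curvature fields.
Smoothness near x is required since curvature and tensor must be identified at nearby points. -/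
lemma smoothAt_ricci (hX : SmoothNear X x) : SmoothAt (fun y ↦ g.ricci y (X y)) x := by
  refine g.smoothAt_of_val_frame fun k ↦ ?_
  have hF (l) := smoothAt_frame (E := E) x l
  have hR (l) : SmoothAt (g.curvature X (frame E x l) (frame E x k)) x :=
    (g.smoothAt_nabla (hX.smoothAt.mlieBracket (hF l)) (hF k)).sub
      ((g.smoothAt_nabla hX.smoothAt (g.smoothAt_nabla (hF l) (hF k))).sub
        (g.smoothAt_nabla (hF l) (g.smoothAt_nabla hX.smoothAt (hF k))))
  refine (contMDiffAt_finsetSum (t := Finset.univ)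
    fun l _ ↦ frameCoeff_smooth (hR l) l).congr_of_eventuallyEq ?_
  filter_upwards [hX, eventually_trace_eq (E := E) x,
    Filter.eventually_all.2 (eventually_smoothAt_frame (E := E) x)] with y hXy htr hFy
  rw [val_ricci, htr]
  refine Finset.sum_congr rfl fun l _ ↦ ?_
  rw [g.curvature_eq_riemann hXy (hFy l) (hFy k), LinearMap.flip_apply]

lemma smoothNear_ricci (hX : SmoothNear X x) : SmoothNear (fun y ↦ g.ricci y (X y)) x := by
  filter_upwards [eventually_eventually_nhds.2 hX] with y hy
  exact g.smoothAt_ricci hy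

lemma smoothNear_ricci_pow (hX : SmoothNear X x) (n : ℕ) :
    SmoothNear (fun y ↦ (g.ricci y ^ n) (X y)) x := by
  induction n with
  | zero => simpa using hX
  | succ n ih =>
    simp only [pow_succ', Module.End.mul_apply]
    exact g.smoothNear_ricci ih

lemma smoothNear_aeval {p : M → ℝ[X]} {N : ℕ} (hU : U ∈ 𝓝 x)
    (hp : ∀ k, ContMDiffOn 𝓘(ℝ, E) 𝓘(ℝ) ∞ (fun y ↦ (p y).coeff k) U)
    (hN : ∀ y ∈ U, (p y).natDegree ≤ N) (hX : SmoothNear X x) :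
    SmoothNear (fun y ↦ aeval (g.ricci y) (p y) (X y)) x := by
  filter_upwards [Filter.eventually_all_finset (Finset.range (N + 1)) |>.2
    fun k _ ↦ g.smoothNear_ricci_pow hX k, eventually_mem_nhds_iff.2 hU] with y hy hUy
  refine (SmoothAt.sum fun k hk ↦
    SmoothAt.smul ((hp k).contMDiffAt hUy) (hy k hk)).congr ?_
  filter_upwards [hUy] with z hz
  rw [aeval_eq_sum_range' (Nat.lt_succ_of_le (hN z hz))]
  simp

variable {g}

lemma IsRicciFactorFamily.smoothNear_aeval (hP : g.IsRicciFactorFamily U P) (hU : U ∈ 𝓝 x)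
    (i : Fin r) (hX : SmoothNear X x) : SmoothNear (fun y ↦ aeval (g.ricci y) (P i y) (X y)) x :=
  g.smoothNear_aeval hU (hP.smooth i) (fun _ hy ↦ hP.natDegree_le hy i) hX

lemma IsRicciFactorFamily.smoothNear_factorProd (hP : g.IsRicciFactorFamily U P) (hU : U ∈ 𝓝 x)
    (S : Finset (Fin r)) (hX : SmoothNear X x) :
    SmoothNear (fun y ↦ aeval (g.ricci y) (factorProd P S y) (X y)) x := by
  induction S using Finset.induction_on with
  | empty => simpa [factorProd] using g.smoothNear_ricci_pow hX 2
  | insert j S hj ih =>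
    have h (y : M) : factorProd P (insert j S) y = P j y * factorProd P S y := by
      simp only [factorProd, Finset.prod_insert hj]
      ring
    simp only [h, map_mul, Module.End.mul_apply]
    exact hP.smoothNear_aeval hU j ih

/-- Polynomials in Ric pass through every slot, so the value lies in both kernels, which meet only
in 0. -/
lemma IsSemiSymmetric.riemann_eq_zero (hg : g.IsSemiSymmetric) {p q : M → ℝ[X]}
    (h : IsCoprime (p x) (q x)) {u v w : TangentSpace 𝓘(ℝ, E) x}
    (hp : u ∈ g.kerRicci p x ∨ v ∈ g.kerRicci p x ∨ w ∈ g.kerRicci p x)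
    (hq : u ∈ g.kerRicci q x ∨ v ∈ g.kerRicci q x ∨ w ∈ g.kerRicci q x) :
    g.riemann x u v w = 0 := by
  have key {p : M → ℝ[X]} (hp : u ∈ g.kerRicci p x ∨ v ∈ g.kerRicci p x ∨ w ∈ g.kerRicci p x) :
      g.riemann x u v w ∈ g.kerRicci p x := by
    simp only [mem_kerRicci] at hp ⊢
    rcases hp with hp | hp | hp
    · rw [← hg.riemann_aeval_left, hp]
      simp
    · rw [← hg.riemann_aeval_mid, hp]
      simp
    · rw [← hg.riemann_aeval_right, hp]
      simp
  exact eq_zero_of_kerRicci h (key hp) (key hq)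

lemma IsRicciFactorFamily.riemann_nabla_eq_zero (hg : g.IsSemiSymmetric)
    (hP : g.IsRicciFactorFamily U P) (hU : U ∈ 𝓝 x) {i : Fin r} (hX : SmoothNear X x)
    (hW : SmoothNear W x) (hX' : ∀ᶠ y in 𝓝 x, X y ∈ g.complKer P i y)
    (hW' : ∀ᶠ y in 𝓝 x, W y ∈ g.complKer P i y) (v w : TangentSpace 𝓘(ℝ, E) x) :
    g.riemann x (aeval (g.ricci x) (factorProd P (Finset.univ.erase i) x) v)
      (aeval (g.ricci x) (factorProd P (Finset.univ.erase i) x) w) (g.nabla X W x) = 0 := by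
  have hx := mem_of_mem_nhds hU
  set Q := factorProd P (Finset.univ.erase i) with hQ
  have hcop {y : M} (hy : y ∈ U) : IsCoprime (P i y) (Q y) :=
    hP.isCoprime_factorProd hy (Finset.notMem_erase i Finset.univ)
  have hPQ {y : M} (hy : y ∈ U) (v) :
      aeval (g.ricci y) (P i y) (aeval (g.ricci y) (Q y) v) = 0 := by
    rw [← Module.End.mul_apply, ← map_mul, hP.aeval_mul_complKer hg hy, LinearMap.zero_apply]
  -- Since P_i Q annihilates Ric, applying Q(Ric) to any smooth field gives a smooth section of V_i.
  -- This supplies local sections of V_i with no need for a frame of it.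
  let Y (y : M) := aeval (g.ricci y) (Q y) (FiberBundle.extend E v y)
  let Z (y : M) := aeval (g.ricci y) (Q y) (FiberBundle.extend E w y)
  have hY : SmoothNear Y x := hP.smoothNear_factorProd hU _ (SmoothAt.eventually_extend v)
  have hZ : SmoothNear Z x := hP.smoothNear_factorProd hU _ (SmoothAt.eventually_extend w)
  have hY' {y : M} (hy : y ∈ U) : Y y ∈ g.kerRicci (P i) y := hPQ hy _
  have hZ' {y : M} (hy : y ∈ U) : Z y ∈ g.kerRicci (P i) y := hPQ hy _
  have hYx : Y x = aeval (g.ricci x) (Q x) v := by simp [Y]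
  have hZx : Z x = aeval (g.ricci x) (Q x) w := by simp [Z]
  have B := g.curvature_bianchi hX.smoothAt hY.smoothAt hZ.smoothAt hW.smoothAt
  have zero {V F : Π x : M, TangentSpace 𝓘(ℝ, E) x} (h : ∀ᶠ y in 𝓝 x, 0 = F y) :
      g.nabla V F x = 0 := by
    rw [← g.nabla_congr_right (Y := 0) SmoothAt.zero h]
    simp [nabla]
  have n1 : g.nabla X (g.curvature Y Z W) x = 0 := zero <| by
    filter_upwards [hU, hY, hZ, hW, hW'] with y hy h1 h2 h3 h4
    rw [g.curvature_eq_riemann h1 h2 h3]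
    exact (hg.riemann_eq_zero (hcop hy) (.inl (hY' hy)) (.inr (.inr h4))).symm
  have n2 : g.nabla Y (g.curvature Z X W) x = 0 := zero <| by
    filter_upwards [hU, hX, hZ, hW, hW'] with y hy h1 h2 h3 h4
    rw [g.curvature_eq_riemann h2 h1 h3]
    exact (hg.riemann_eq_zero (hcop hy) (.inl (hZ' hy)) (.inr (.inr h4))).symm
  have n3 : g.nabla Z (g.curvature X Y W) x = 0 := zero <| by
    filter_upwards [hU, hX, hY, hW, hW'] with y hy h1 h2 h3 h4
    rw [g.curvature_eq_riemann h1 h2 h3]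
    exact (hg.riemann_eq_zero (hcop hy) (.inr (.inl (hY' hy))) (.inr (.inr h4))).symm
  have hYx' := hY' hx
  have hZx' := hZ' hx
  have hXx' := hX'.self_of_nhds
  have hWx' := hW'.self_of_nhds
  rw [n1, n2, n3,
    g.curvature_eq_riemann hY.smoothAt hZ.smoothAt (g.smoothAt_nabla hX.smoothAt hW.smoothAt),
    g.curvature_eq_riemann hZ.smoothAt hX.smoothAt (g.smoothAt_nabla hY.smoothAt hW.smoothAt),
    g.curvature_eq_riemann hX.smoothAt hY.smoothAt (g.smoothAt_nabla hZ.smoothAt hW.smoothAt),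
    g.curvature_eq_riemann (hY.smoothAt.mlieBracket hZ.smoothAt) hX.smoothAt hW.smoothAt,
    g.curvature_eq_riemann (hZ.smoothAt.mlieBracket hX.smoothAt) hY.smoothAt hW.smoothAt,
    g.curvature_eq_riemann (hX.smoothAt.mlieBracket hY.smoothAt) hZ.smoothAt hW.smoothAt,
    hg.riemann_eq_zero (hcop hx) (.inl hZx') (.inr (.inl hXx')),
    hg.riemann_eq_zero (hcop hx) (.inr (.inl hYx')) (.inl hXx'),
    hg.riemann_eq_zero (u := VectorField.mlieBracket 𝓘(ℝ, E) Z X x) (hcop hx)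
      (.inr (.inl hYx')) (.inr (.inr hWx')),
    hg.riemann_eq_zero (u := VectorField.mlieBracket 𝓘(ℝ, E) X Y x) (hcop hx)
      (.inr (.inl hZx')) (.inr (.inr hWx'))] at B
  simp only [sub_zero, add_zero, zero_sub] at B
  rw [← hYx, ← hZx]
  -- `B` now equates -R(Y,Z)∇_X W with R([Y,Z],X)W: the first is in V_i because of Y, the second in
  -- K_i because of W.
  have m1 : g.riemann x (Y x) (Z x) (g.nabla X W x) ∈ g.kerRicci (P i) x := by
    rw [mem_kerRicci, ← hg.riemann_aeval_left, (mem_kerRicci).1 hYx']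
    simp
  have m2 : g.riemann x (Y x) (Z x) (g.nabla X W x) ∈ g.kerRicci Q x := by
    rw [← neg_mem_iff, B, mem_kerRicci, ← hg.riemann_aeval_right, (mem_kerRicci).1 hWx',
      map_zero]
  exact eq_zero_of_kerRicci (hcop hx) m1 m2

/-- The distribution `complKer g P i` is totally geodesic. -/
theorem IsRicciFactorFamily.nabla_mem_complKer (hg : g.IsSemiSymmetric)
    (hP : g.IsRicciFactorFamily U P) (hU : U ∈ 𝓝 x) {i : Fin r} (hX : SmoothNear X x)
    (hW : SmoothNear W x) (hX' : ∀ᶠ y in 𝓝 x, X y ∈ g.complKer P i y)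
    (hW' : ∀ᶠ y in 𝓝 x, W y ∈ g.complKer P i y) : g.nabla X W x ∈ g.complKer P i x := by
  have hx := mem_of_mem_nhds hU
  set Q := factorProd P (Finset.univ.erase i) with hQ
  have hcop {y : M} (hy : y ∈ U) : IsCoprime (P i y) (Q y) :=
    hP.isCoprime_factorProd hy (Finset.notMem_erase i Finset.univ)
  have hPQ {y : M} (hy : y ∈ U) (v) :
      aeval (g.ricci y) (P i y) (aeval (g.ricci y) (Q y) v) = 0 := by
    rw [← Module.End.mul_apply, ← map_mul, hP.aeval_mul_complKer hg hy, LinearMap.zero_apply]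
  have main := hP.riemann_nabla_eq_zero hg hU hX hW hX' hW'
  set u := g.nabla X W x
  -- Moving both factors Q(Ric) from the first two slots onto u shows that every R(v,w) kills
  -- Q(Ric)²u.
  have h1 : g.ricci x (aeval (g.ricci x) (Q x) (aeval (g.ricci x) (Q x) u)) = 0 := by
    refine ricci_eq_zero_of_riemann fun v w ↦ ?_
    rw [hg.riemann_aeval_right, ← hg.riemann_aeval_mid, hg.riemann_aeval_right,
      ← hg.riemann_aeval_left]
    exact main v w
  -- Q(Ric)u lies in V_i and is killed by (XQ)(Ric); coprimality makes it 0, which is membership of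
  -- u in K_i.
  have hc : IsCoprime (P i x) (Polynomial.X * Q x) := (hP.isCoprime_X hx i).mul_right (hcop hx)
  refine eq_zero_of_kerRicci (p := P i) (q := fun x ↦ Polynomial.X * Q x) hc (hPQ hx u) ?_
  rw [mem_kerRicci, map_mul, aeval_X]
  exact h1

/-- `ker P i (Ric)` is parallel along `complKer g P i`. -/
theorem IsRicciFactorFamily.nabla_mem_kerRicci (hg : g.IsSemiSymmetric)
    (hP : g.IsRicciFactorFamily U P) (hU : U ∈ 𝓝 x) {i : Fin r} (hX : SmoothNear X x)
    (hY : SmoothNear Y x) (hX' : ∀ᶠ y in 𝓝 x, X y ∈ g.complKer P i y)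
    (hY' : ∀ᶠ y in 𝓝 x, Y y ∈ g.kerRicci (P i) y) : g.nabla X Y x ∈ g.kerRicci (P i) x := by
  have hx := mem_of_mem_nhds hU
  rw [mem_kerRicci]
  refine g.nondegenerate x _ fun w ↦ ?_
  rw [val_aeval_ricci_comm]
  -- P_i(Ric) maps into K_i, so g(Y,W) vanishes near x. Differentiating along X and using that K_i
  -- is totally geodesic leaves g(∇_X Y, W) = 0.
  let W (y : M) := aeval (g.ricci y) (P i y) (FiberBundle.extend E w y)
  have hW : SmoothNear W x := hP.smoothNear_aeval hU i (SmoothAt.eventually_extend w)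
  have hW' {y : M} (hy : y ∈ U) : W y ∈ g.complKer P i y := by
    rw [complKer, mem_kerRicci, ← Module.End.mul_apply, ← map_mul, mul_comm,
      hP.aeval_mul_complKer hg hy, LinearMap.zero_apply]
  have hcop {y : M} (hy : y ∈ U) : IsCoprime (P i y) (factorProd P (Finset.univ.erase i) y) :=
    hP.isCoprime_factorProd hy (Finset.notMem_erase i Finset.univ)
  have h1 := g.mvfderiv_val hX.smoothAt.mdifferentiableAt hY.smoothAt.mdifferentiableAt
    hW.smoothAt.mdifferentiableAt
  have h2 : (fun y ↦ g.val y (Y y) (W y)) =ᶠ[𝓝 x] fun _ ↦ 0 := by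
    filter_upwards [hU, hY'] with y hy h
    exact val_eq_zero_of_kerRicci (hcop hy) h (hW' hy)
  have hUW : ∀ᶠ y in 𝓝 x, W y ∈ g.complKer P i y := by
    filter_upwards [hU] with y hy
    exact hW' hy
  rw [mvfderiv_congr h2, mvfderiv_const, val_eq_zero_of_kerRicci (hcop hx) hY'.self_of_nhds
    (hP.nabla_mem_complKer hg hU hX hW hX' hUW), add_zero] at h1
  have hWx : W x = aeval (g.ricci x) (P i x) w := by simp [W]
  rw [← hWx, ← h1]
  rfl

end Metric

/-! ### From the K_j to V_0 and V_0 + V_i. -/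

variable {g : Metric E M} {U : Set M} {r : ℕ} {P : Fin r → M → ℝ[X]}

lemma IsSectionOn.smoothNear {D : Π x : M, Submodule ℝ (TangentSpace 𝓘(ℝ, E) x)}
    {X : Π x : M, TangentSpace 𝓘(ℝ, E) x} {W : Set M} (h : IsSectionOn D X W) (hW : IsOpen W)
    {x : M} (hx : x ∈ W) : SmoothNear X x := by
  filter_upwards [hW.mem_nhds hx] with y hy
  exact h.1.contMDiffAt (hW.mem_nhds hy)

lemma IsSectionOn.mono {D D' : Π x : M, Submodule ℝ (TangentSpace 𝓘(ℝ, E) x)}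
    {X : Π x : M, TangentSpace 𝓘(ℝ, E) x} {W : Set M} (h : IsSectionOn D X W)
    (hD : ∀ x, D x ≤ D' x) : IsSectionOn D' X W :=
  ⟨h.1, fun x hx ↦ hD x (h.2 x hx)⟩

lemma IsSectionOn.eventually_mem {D : Π x : M, Submodule ℝ (TangentSpace 𝓘(ℝ, E) x)}
    {X : Π x : M, TangentSpace 𝓘(ℝ, E) x} {W : Set M} (h : IsSectionOn D X W) (hW : IsOpen W)
    {x : M} (hx : x ∈ W) : ∀ᶠ y in 𝓝 x, X y ∈ D y :=
  Filter.eventually_of_mem (hW.mem_nhds hx) h.2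

namespace Metric

lemma CovDerivSubset.mono {D₁ D₂ D₁' D₂' D₃ : Π x : M, Submodule ℝ (TangentSpace 𝓘(ℝ, E) x)}
    (h : g.CovDerivSubset U D₁ D₂ D₃) (h₁ : ∀ x, D₁' x ≤ D₁ x) (h₂ : ∀ x, D₂' x ≤ D₂ x) :
    g.CovDerivSubset U D₁' D₂' D₃ :=
  fun W hWU hW X Y hX hY ↦ h W hWU hW X Y (hX.mono h₁) (hY.mono h₂)

/-- Vanishing torsion: [X,Y] = ∇_X Y - ∇_Y X. -/
lemma CovDerivSubset.isInvolutiveOn {D : Π x : M, Submodule ℝ (TangentSpace 𝓘(ℝ, E) x)}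
    (h : g.CovDerivSubset U D D D) : IsInvolutiveOn D U := by
  intro W hWU hW X Y hX hY x hx
  rw [← g.leviCivita_torsion (hX.smoothNear hW hx).smoothAt.mdifferentiableAt
    (hY.smoothNear hW hx).smoothAt.mdifferentiableAt]
  exact sub_mem (h W hWU hW X Y hX hY x hx) (h W hWU hW Y X hY hX x hx)

lemma IsRicciFactorFamily.covDerivSubset_complKer (hg : g.IsSemiSymmetric)
    (hP : g.IsRicciFactorFamily U P) (i : Fin r) :
    g.CovDerivSubset U (g.complKer P i) (g.complKer P i) (g.complKer P i) :=
  fun _ hWU hW _ _ hX hY _ hx ↦ hP.nabla_mem_complKer hg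
    (Filter.mem_of_superset (hW.mem_nhds hx) hWU) (hX.smoothNear hW hx) (hY.smoothNear hW hx)
    (hX.eventually_mem hW hx) (hY.eventually_mem hW hx)

lemma IsRicciFactorFamily.covDerivSubset_kerRicci (hg : g.IsSemiSymmetric)
    (hP : g.IsRicciFactorFamily U P) (i : Fin r) :
    g.CovDerivSubset U (g.complKer P i) (g.kerRicci (P i)) (g.kerRicci (P i)) :=
  fun _ hWU hW _ _ hX hY _ hx ↦ hP.nabla_mem_kerRicci hg
    (Filter.mem_of_superset (hW.mem_nhds hx) hWU) (hX.smoothNear hW hx) (hY.smoothNear hW hx)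
    (hX.eventually_mem hW hx) (hY.eventually_mem hW hx)

lemma V₀_sup_le_complKer {i j : Fin r} (h : i ≠ j) (x : M) :
    g.V₀ x ⊔ g.kerRicci (P i) x ≤ g.complKer P j x :=
  sup_le (V₀_le_complKer j) (kerRicci_le_complKer h)

lemma IsRicciFactorFamily.covDerivSubset_V₀_sup (hg : g.IsSemiSymmetric)
    (hP : g.IsRicciFactorFamily U P) (i : Fin r) :
    g.CovDerivSubset U (fun x ↦ g.V₀ x ⊔ g.kerRicci (P i) x)
      (fun x ↦ g.V₀ x ⊔ g.kerRicci (P i) x) (fun x ↦ g.V₀ x ⊔ g.kerRicci (P i) x) := by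
  intro W hWU hW X Y hX hY x hx
  -- If i is the only index, no condition is imposed: V_0 + V_i is then the whole tangent space.
  exact hP.mem_V₀_sup hg (hWU hx) fun j hj ↦ hP.covDerivSubset_complKer hg j W hWU hW X Y
    (hX.mono (V₀_sup_le_complKer hj.symm)) (hY.mono (V₀_sup_le_complKer hj.symm)) x hx

lemma IsRicciFactorFamily.covDerivSubset_V₀ (hg : g.IsSemiSymmetric)
    (hP : g.IsRicciFactorFamily U P) : g.CovDerivSubset U g.V₀ g.V₀ g.V₀ := by
  intro W hWU hW X Y hX hY x hx
  exact hP.mem_V₀ hg (hWU hx) fun j ↦ hP.covDerivSubset_complKer hg j W hWU hW X Y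
    (hX.mono fun _ ↦ V₀_le_complKer j) (hY.mono fun _ ↦ V₀_le_complKer j) x hx

end Metric

end PseudoRiem

end

theorem mainTheorem10
    {E : Type*} [NormedAddCommGroup E] [NormedSpace ℝ E] [FiniteDimensional ℝ E]
    {M : Type*} [TopologicalSpace M] [ChartedSpace E M] [IsManifold 𝓘(ℝ, E) ∞ M]
    (g : PseudoRiem.Metric E M) (hg : g.IsSemiSymmetric)
    (U : Set M) (hU : IsOpen U) {r : ℕ} (P : Fin r → M → Polynomial ℝ)
    (hP : g.IsRicciFactorFamily U P) :
    (∀ i j, i ≠ j →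
      g.CovDerivSubset U (g.kerRicci (P j)) (g.kerRicci (P i)) (g.kerRicci (P i))) ∧
    (∀ i, g.CovDerivSubset U (g.kerRicci (P i)) (g.kerRicci (P i))
      (fun x ↦ g.V₀ x ⊔ g.kerRicci (P i) x)) ∧
    (∀ i, g.CovDerivSubset U g.V₀ (g.kerRicci (P i)) (g.kerRicci (P i))) ∧
    g.CovDerivSubset U g.V₀ g.V₀ g.V₀ ∧
    (∀ i, g.CovDerivSubset U (g.kerRicci (P i)) g.V₀
      (fun x ↦ g.V₀ x ⊔ g.kerRicci (P i) x)) ∧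
    PseudoRiem.IsInvolutiveOn g.V₀ U ∧
    (∀ i, PseudoRiem.IsInvolutiveOn (fun x ↦ g.V₀ x ⊔ g.kerRicci (P i) x) U) := by
  refine ⟨fun i j hij ↦ ?_, fun i ↦ ?_, fun i ↦ ?_, hP.covDerivSubset_V₀ hg, fun i ↦ ?_,
    (hP.covDerivSubset_V₀ hg).isInvolutiveOn,
    fun i ↦ (hP.covDerivSubset_V₀_sup hg i).isInvolutiveOn⟩
  · exact (hP.covDerivSubset_kerRicci hg i).mono
      (fun _ ↦ PseudoRiem.Metric.kerRicci_le_complKer hij.symm) fun _ ↦ le_rfl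
  · exact (hP.covDerivSubset_V₀_sup hg i).mono (fun _ ↦ le_sup_right) fun _ ↦ le_sup_right
  · exact (hP.covDerivSubset_kerRicci hg i).mono
      (fun _ ↦ PseudoRiem.Metric.V₀_le_complKer i) fun _ ↦ le_rfl
  · exact (hP.covDerivSubset_V₀_sup hg i).mono (fun _ ↦ le_sup_right) fun _ ↦ le_sup_left
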